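/- Let $0 < x_0 < 1$ and $\epsilon \ge 0$. Let $\mathcal H_0$ be the space of absolutely continuous functions $\Psi : [-x_0,x_0] \to \mathbb C$ with $\|\Psi\|^2 = \int_{-x_0}^{x_0} (1-x^2)|\Psi'(x)|^2\,dx < \infty$, where functions that differ by an additive constant are identified, and consider the eigenvalue problem $$ L_0\Psi = \Phi, \qquad \Phi' + \frac{\epsilon}{1-x^2}\,\Phi = \mu \Psi', \qquad L_0 = \frac{d}{dx}\Big[(1-x^2)\frac{d}{dx}\Big], $$ for $\Psi \in X_0 = \{\Psi \in \mathcal H_0 : \Psi'(\pm x_0) = 0\}$ with $\Psi'$ absolutely continuous and $\Phi$ absolutely continuous with $\Phi' \in L^2(-x_0,x_0)$. A number $\mu \in \mathbb C$ is in the resolvent set if for each $F \in \mathcal H_0$ there is exactly one such $\Psi \in X_0$ (up to an additive constant) that solves $L_0\Psi = \Phi$, $\Phi' + \frac{\epsilon}{1-x^2}\Phi - \mu\Psi' = F'$, and $\|\Psi\| \le C\|F\|$ with a constant $C$ that does not depend on $F$; the spectrum is the complement of the resolvent set in $\mathbb C$. Then the spectrum is an infinite set that consists exactly of the eigenvalues,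 i.e. the $\mu$ for which the problem has a non-constant solution $\Psi \in X_0$. Every $\mu$ in the spectrum is real and strictly negative, is an isolated point of the spectrum, and is a simple eigenvalue, geometrically (up to multiples and additive constants there is only one non-constant solution) and algebraically (there is no Jordan chain of length two). -/

import Mathlib

open MeasureTheory Set

namespace SphericalLayer

/-- `F` is absolutely continuous on `[-x₀, x₀]` and its derivative is `f ∈ L²(-x₀, x₀)`
(functions are complex valued; values outside `[-x₀, x₀]` are irrelevant).
Since `1 - x²` is bounded above and below on `[-x₀, x₀]` for `0 < x₀ < 1`, the functions `F` that
have such a derivative form the energy space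
`𝓗₀([-x₀, x₀]) = {F : ∫ (1 - x²) |F'|² dx < ∞}`. -/
def HasL2Deriv (x₀ : ℝ) (F f : ℝ → ℂ) : Prop :=
  MemLp f 2 (volume.restrict (Icc (-x₀) x₀)) ∧
    ∀ x ∈ Icc (-x₀) x₀, F x = F (-x₀) + ∫ t in (-x₀)..x, f t

/-- The squared energy norm `‖F‖²_{𝓗₀} = ∫_{-x₀}^{x₀} (1 - x²) |F'(x)|² dx`, as a function of
`f = F'`. It vanishes exactly for constant `F`. -/
noncomputable def energySq (x₀ : ℝ) (f : ℝ → ℂ) : ℝ :=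
  ∫ x in (-x₀)..x₀, (1 - x ^ 2) * ‖f x‖ ^ 2

/-- `F` is constant on `[-x₀, x₀]`, i.e. `F` is zero in the energy space. -/
def IsConstOn (x₀ : ℝ) (F : ℝ → ℂ) : Prop :=
  ∃ c : ℂ, ∀ x ∈ Icc (-x₀) x₀, F x = c

/-- The linearized system with forcing `F` in the energy space:
`L₀ Ψ = Φ` with `L₀ = d/dx ((1 - x²) d/dx)`, and `Φ' + ε / (1 - x²) Φ - μ Ψ' = F'`, for
`Ψ` in the space `X₀`, i.e. `Ψ'(±x₀) = 0`. Here `ψ = Ψ'`, `φ = Φ'` and `f = F'`; since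
`(1 - x²) ψ` has the derivative `Φ`, the function `ψ` is continuous and its boundary values make
sense. For `F = 0` this is the eigenvalue problem. -/
def System (x₀ ε : ℝ) (μ : ℂ) (Ψ Φ F : ℝ → ℂ) : Prop :=
  ∃ ψ φ f : ℝ → ℂ,
    HasL2Deriv x₀ Ψ ψ ∧ ψ (-x₀) = 0 ∧ ψ x₀ = 0 ∧
    HasL2Deriv x₀ (fun x => ((1 - x ^ 2 : ℝ) : ℂ) * ψ x) Φ ∧
    HasL2Deriv x₀ Φ φ ∧
    HasL2Deriv x₀ F f ∧
    ∀ᵐ x ∂(volume.restrict (Icc (-x₀) x₀)),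
      φ x + ((ε / (1 - x ^ 2) : ℝ) : ℂ) * Φ x - μ * ψ x = f x

/-- `(Ψ, Φ)` is an eigenfunction for `μ`: it solves the homogeneous system in `X₀` and `Ψ` is not
constant (constants solve the system, with `Φ = 0`, for every `μ`). -/
def IsEigenfunction (x₀ ε : ℝ) (μ : ℂ) (Ψ Φ : ℝ → ℂ) : Prop :=
  System x₀ ε μ Ψ Φ 0 ∧ ¬ IsConstOn x₀ Ψ

/-- `μ` is an eigenvalue of the system in `X₀` (modulo constants). -/
def IsEigenvalue (x₀ ε : ℝ) (μ : ℂ) : Prop :=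
  ∃ Ψ Φ : ℝ → ℂ, IsEigenfunction x₀ ε μ Ψ Φ

/-- `μ` is a resolvent point of the system in `X₀` (modulo constants): for every forcing `F` in the
energy space there is a solution `Ψ`, it is unique up to an additive constant, and the solution map
`F ↦ Ψ` is bounded in the energy norm. -/
def IsResolventPoint (x₀ ε : ℝ) (μ : ℂ) : Prop :=
  (∀ F f : ℝ → ℂ, HasL2Deriv x₀ F f → ∃ Ψ Φ : ℝ → ℂ, System x₀ ε μ Ψ Φ F) ∧
  (∀ Ψ Φ : ℝ → ℂ, System x₀ ε μ Ψ Φ 0 → IsConstOn x₀ Ψ) ∧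
  ∃ C : ℝ, ∀ Ψ ψ Φ F f : ℝ → ℂ, System x₀ ε μ Ψ Φ F → HasL2Deriv x₀ Ψ ψ → HasL2Deriv x₀ F f →
    energySq x₀ ψ ≤ C * energySq x₀ f

/-- The complete spectrum of the system in `X₀` (modulo constants). -/
def layerSpectrum (x₀ ε : ℝ) : Set ℂ :=
  {μ | ¬ IsResolventPoint x₀ ε μ}

/-- The eigenvalue `μ` is geometrically simple: modulo constants, the eigenfunctions are
the multiples of one eigenfunction. -/
def IsGeometricallySimple (x₀ ε : ℝ) (μ : ℂ) : Prop :=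
  ∃ Ψ₀ Φ₀ : ℝ → ℂ, IsEigenfunction x₀ ε μ Ψ₀ Φ₀ ∧
    ∀ Ψ Φ : ℝ → ℂ, System x₀ ε μ Ψ Φ 0 →
      ∃ c d : ℂ, ∀ x ∈ Icc (-x₀) x₀, Ψ x = c * Ψ₀ x + d

/-- There are no Jordan chains of length two for `μ`: no eigenfunction `Ψ` is the image
`(T - μ) Ψ₁` of a function `Ψ₁`, where `T` is the operator in the energy space modulo constants
that is given by the system. -/
def HasNoJordanChain (x₀ ε : ℝ) (μ : ℂ) : Prop :=
  ∀ Ψ Φ : ℝ → ℂ, IsEigenfunction x₀ ε μ Ψ Φ → ∀ Ψ₁ Φ₁ : ℝ → ℂ, ¬ System x₀ ε μ Ψ₁ Φ₁ Ψ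

end SphericalLayer

/-! Write `w = 1 - x²`, `p = w ψ` and `g = exp (logFactor ε)`, so that `g' = ε g / w`. The system
becomes `p' = Φ`, `(g Φ)' = g (μ ψ + f)` with `p(±x₀) = 0`, that is, the Dirichlet Sturm-Liouville
problem `(g p')' = (g / w) (μ p + w f)`. The apparently non-self-adjoint term is absorbed by the
integrating factor `g`.

With `e² = 1 / g`, `s² = g / w` and the symmetrized unknown `u = s p = s w ψ` (`stateVec`), the
problem is equivalent to `u = T (μ u + v)` in `L²`, where `v = s w f` and `T` (`layerOp`) is the
Dirichlet solution operator (`System.stateVec_eq`, `exists_system_of_eq`). The operator factors as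
`T = -B B*`, where `B` is a Volterra operator between weights, restricted to `e^⊥`. Hence `T` is
compact, symmetric and nonpositive, and it is injective because the weights are positive.

The rest is spectral theory of `T`. The equation `(1 - μ T) u = T v` has the Fredholm alternative,
so the spectrum is the set of `μ` for which `u = μ T u` has a nonzero solution (`layerSpectrum_eq`).
Symmetry and sign make these `μ` real and negative and exclude Jordan chains; compactness isolates
them; injectivity in an infinite-dimensional space makes them infinitely many. Geometric simplicity
is the uniqueness of the initial value problem at `-x₀` (`exists_smul_eq_of_sturm`). -/

namespace SphericalLayer

open Module End

/-! ### Characteristic values of compact symmetric operators in a Hilbert space. -/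

section Abstract

variable {H : Type*} [NormedAddCommGroup H] [InnerProductSpace ℂ H]

/-- `μ` is a characteristic value of `T`: `u = μ T u` has a nonzero solution. -/
def IsCharValue (T : H →L[ℂ] H) (μ : ℂ) : Prop :=
  ∃ u, u ≠ 0 ∧ u = μ • T u

lemma IsCharValue.ne_zero {T : H →L[ℂ] H} {μ : ℂ} (h : IsCharValue T μ) : μ ≠ 0 := by
  rintro rfl
  obtain ⟨u, hu, h⟩ := h
  exact hu (by simpa using h)

lemma mem_eigenspace_inv {T : H →L[ℂ] H} {μ : ℂ} (hμ : μ ≠ 0) {u : H} :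
    u ∈ eigenspace (T : End ℂ H) μ⁻¹ ↔ u = μ • T u := by
  rw [mem_eigenspace_iff]
  constructor
  · intro h
    have : T u = μ⁻¹ • u := h
    rw [this, smul_inv_smul₀ hμ]
  · intro h
    change T u = μ⁻¹ • u
    rw [eq_inv_smul_iff₀ hμ]
    exact h.symm

lemma isCharValue_iff_hasEigenvalue {T : H →L[ℂ] H} {μ : ℂ} (hμ : μ ≠ 0) :
    IsCharValue T μ ↔ HasEigenvalue (T : End ℂ H) μ⁻¹ := by
  rw [hasEigenvalue_iff, Submodule.ne_bot_iff]
  simp only [mem_eigenspace_inv hμ, IsCharValue]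
  exact ⟨fun ⟨u, h0, h⟩ => ⟨u, h, h0⟩, fun ⟨u, h, h0⟩ => ⟨u, h0, h⟩⟩

/-- Pairing `u = μ T u` with `u` gives `‖u‖² = conj μ * ⟪T u, u⟫`, where the last factor is real and
nonpositive; since `‖u‖² > 0`, it is negative, and this fixes the argument of `μ`. -/
lemma IsCharValue.real_neg {T : H →L[ℂ] H}
    (hsym : T.IsSymmetric) (hneg : ∀ u, (inner ℂ (T u) u : ℂ).re ≤ 0) {μ : ℂ}
    (h : IsCharValue T μ) : μ.im = 0 ∧ μ.re < 0 := by
  have hμ := h.ne_zero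
  obtain ⟨u, hu, h⟩ := h
  have him : (inner ℂ (T u) u : ℂ).im = 0 := by
    have := hsym.coe_reApplyInnerSelf_apply u
    rw [← this]
    exact Complex.ofReal_im _
  have h1 : (inner ℂ (T u) u : ℂ) = ((inner ℂ (T u) u : ℂ).re : ℂ) :=
    Complex.ext (by simp) (by simp [him])
  have h2 : (starRingEnd ℂ μ) * (inner ℂ (T u) u : ℂ) = ((‖u‖ ^ 2 : ℝ) : ℂ) := by
    rw [← inner_smul_left, ← h, inner_self_eq_norm_sq_to_K]
    simp
  set r := (inner ℂ (T u) u : ℂ).re with hr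
  have hr0 : r ≤ 0 := hneg u
  have hn : 0 < ‖u‖ ^ 2 := by positivity
  rw [h1] at h2
  have hre := congrArg Complex.re h2
  have himm := congrArg Complex.im h2
  rw [Complex.ofReal_re, Complex.mul_re, Complex.conj_re, Complex.ofReal_re, Complex.ofReal_im,
    mul_zero, sub_zero] at hre
  rw [Complex.ofReal_im, Complex.mul_im, Complex.conj_im, Complex.ofReal_re, Complex.ofReal_im,
    mul_zero, zero_add, neg_mul, neg_eq_zero, mul_eq_zero] at himm
  have hrne : r ≠ 0 := by
    intro h0
    rw [h0, mul_zero] at hre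
    exact hn.ne hre
  refine ⟨himm.resolve_right hrne, ?_⟩
  have : r < 0 := lt_of_le_of_ne hr0 hrne
  by_contra! hc
  nlinarith

variable [CompleteSpace H]

/-- The Fredholm alternative for `1 - μ T`. -/
lemma exists_inverse_of_not_isCharValue {T : H →L[ℂ] H} (hT : IsCompactOperator T) {μ : ℂ}
    (h : ¬ IsCharValue T μ) :
    ∃ R : H →L[ℂ] H, ∀ u v : H, u = μ • T u + v ↔ u = R v := by
  have hu : IsUnit ((1 : H →L[ℂ] H) - μ • T) := by
    by_cases hμ : μ = 0
    · simp [hμ]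
    have h1 := (hT.hasEigenvalue_or_mem_resolventSet (inv_ne_zero hμ)).resolve_left
      (fun h' => h ((isCharValue_iff_hasEigenvalue hμ).2 h'))
    rw [spectrum.mem_resolventSet_iff] at h1
    have h2 : (1 : H →L[ℂ] H) - μ • T = (Units.mk0 μ hμ) •
        (algebraMap ℂ (H →L[ℂ] H) μ⁻¹ - T) := by
      rw [Units.smul_mk0, Algebra.algebraMap_eq_smul_one, smul_sub, smul_inv_smul₀ hμ]
    rw [h2]
    exact h1.smul _
  obtain ⟨U, hU⟩ := hu
  refine ⟨(↑U⁻¹ : H →L[ℂ] H), fun u v => ?_⟩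
  have key : u = μ • T u + v ↔ (U : H →L[ℂ] H) u = v := by
    rw [hU]
    simp only [sub_apply, one_apply_eq_self,
      smul_apply]
    rw [sub_eq_iff_eq_add, add_comm]
  rw [key]
  constructor
  · rintro rfl
    rw [← mul_apply_eq_comp, Units.inv_mul, one_apply_eq_self]
  · rintro rfl
    rw [← mul_apply_eq_comp, Units.mul_inv, one_apply_eq_self]

/-- With finitely many eigenvalues the eigenspaces, each finite-dimensional by compactness (for `0`
by injectivity), would span a finite-dimensional space; by the spectral theorem its orthogonal
complement is zero, so it would be all of `H`. -/
lemma isCharValue_infinite {T : H →L[ℂ] H} (hT : IsCompactOperator T) (hsym : T.IsSymmetric)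
    (hinj : ∀ u, T u = 0 → u = 0) (hH : ¬ FiniteDimensional ℂ H) :
    {μ | IsCharValue T μ}.Infinite := by
  intro hfin
  apply hH
  have hE : {l | HasEigenvalue (T : End ℂ H) l}.Finite := by
    refine (hfin.image (fun μ => μ⁻¹)).subset ?_
    intro l hl
    by_cases h0 : l = 0
    · subst h0
      obtain ⟨v, hv, hv0⟩ := hl.exists_hasEigenvector
      rw [mem_eigenspace_iff] at hv
      exact absurd (hinj v (by simpa using hv)) hv0
    · refine ⟨l⁻¹, ?_, inv_inv l⟩
      rw [mem_ofPred_eq, isCharValue_iff_hasEigenvalue (inv_ne_zero h0), inv_inv]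
      exact hl
  have hsup : (⨆ l, eigenspace (T : End ℂ H) l) =
      ⨆ l ∈ hE.toFinset, eigenspace (T : End ℂ H) l := by
    apply le_antisymm
    · refine iSup_le fun l => ?_
      by_cases hl : HasEigenvalue (T : End ℂ H) l
      · exact le_iSup₂_of_le l (by simpa using hl) le_rfl
      · rw [hasEigenvalue_iff, not_not] at hl
        simp [hl]
    · exact iSup₂_le fun l _ => le_iSup (fun l => eigenspace (T : End ℂ H) l) l
  have hfd : FiniteDimensional ℂ (⨆ l, eigenspace (T : End ℂ H) l : Submodule ℂ H) := by
    rw [hsup]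
    have (l : ℂ) : FiniteDimensional ℂ (eigenspace (T : End ℂ H) l) := by
      by_cases h0 : l = 0
      · have : eigenspace (T : End ℂ H) l = ⊥ := by
          rw [Submodule.eq_bot_iff]
          intro u hu
          rw [mem_eigenspace_iff, h0] at hu
          exact hinj u (by simpa using hu)
        rw [this]
        infer_instance
      · exact ContinuousLinearMap.finite_dimensional_eigenspace hT l h0
    rw [← Finset.sup_eq_iSup]
    infer_instance
  have hbot := ContinuousLinearMap.orthogonalComplement_iSup_eigenspaces_eq_bot hT hsym
  rw [Submodule.orthogonal_eq_bot_iff] at hbot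
  rw [hbot] at hfd
  exact Module.finite_def.2 ((Submodule.fg_top _).1 (Module.finite_def.1 hfd))

/-- On the orthogonal complement of the eigenspace `E` of `μ⁻¹`, the compact operator `T` no longer
has the eigenvalue `μ⁻¹`, so `T - μ⁻¹` is bounded below there. Eigenvectors for any other eigenvalue
`ν⁻¹` lie in this complement, which keeps `ν⁻¹` away from `μ⁻¹`. -/
lemma IsCharValue.isolated {T : H →L[ℂ] H} (hT : IsCompactOperator T) (hsym : T.IsSymmetric)
    {μ : ℂ} (h : IsCharValue T μ) :
    ∃ δ > 0, ∀ ν, IsCharValue T ν → ν ≠ μ → δ ≤ dist ν μ := by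
  have hμ := h.ne_zero
  set E := eigenspace (T : End ℂ H) μ⁻¹ with hE
  have hinv : ∀ v ∈ Eᗮ, T v ∈ Eᗮ := hsym.invariant_orthogonalComplement_eigenspace μ⁻¹
  let S : Eᗮ →L[ℂ] Eᗮ := T.restrict hinv
  have hS : IsCompactOperator S := hT.restrict' hinv
  have hne : ¬ HasEigenvalue (S : End ℂ Eᗮ) μ⁻¹ := by
    intro h'
    obtain ⟨v, hv, hv0⟩ := h'.exists_hasEigenvector
    rw [mem_eigenspace_iff] at hv
    have hvE : (v : H) ∈ E := by
      exact mem_eigenspace_iff.2 (congrArg Subtype.val hv)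
    have := Submodule.inner_right_of_mem_orthogonal hvE v.2
    rw [inner_self_eq_zero] at this
    exact hv0 (by simpa using this)
  obtain ⟨K, hK⟩ := hS.antilipschitz_of_not_hasEigenvalue (inv_ne_zero hμ) hne
  have hbd : ∀ ν, IsCharValue T ν → ν ≠ μ → 1 ≤ (K : ℝ) * ‖ν⁻¹ - μ⁻¹‖ := by
    intro ν hν hne
    have hν0 := hν.ne_zero
    obtain ⟨u, hu, huT⟩ := hν
    have hTu := (mem_eigenspace_inv hν0).2 huT
    have huE : u ∈ Eᗮ := by
      rw [Submodule.mem_orthogonal]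
      intro w hw
      exact hsym.orthogonalFamily_eigenspaces (i := μ⁻¹) (j := ν⁻¹)
          (fun h => hne (inv_injective h).symm) ⟨w, hw⟩ ⟨u, hTu⟩
    rw [mem_eigenspace_iff] at hTu
    have h1 := hK.le_mul_dist ⟨u, huE⟩ 0
    rw [dist_zero_right, map_zero, dist_zero_right] at h1
    have h2 : (S - μ⁻¹ • 1 : Eᗮ →L[ℂ] Eᗮ) ⟨u, huE⟩ = (ν⁻¹ - μ⁻¹) • (⟨u, huE⟩ : Eᗮ) := by
      apply Subtype.ext
      change T u - μ⁻¹ • u = (ν⁻¹ - μ⁻¹) • u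
      rw [sub_smul, ← hTu]
      rfl
    rw [h2, norm_smul] at h1
    have h3 : 0 < ‖(⟨u, huE⟩ : Eᗮ)‖ := by
      rw [norm_pos_iff]
      exact fun h => hu (congrArg Subtype.val h)
    rw [← mul_assoc] at h1
    exact le_of_mul_le_mul_right (by linarith) h3
  have hμn : 0 < ‖μ‖ := norm_pos_iff.2 hμ
  -- If `dist ν μ < ‖μ‖ / 2`, then `‖ν‖ ≥ ‖μ‖ / 2`, and `hbd` reads `‖μ‖² / 2 ≤ ‖ν‖ ‖μ‖ ≤ K * dist ν
  -- μ`. The denominator `K + 1` avoids a division by `K = 0`.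
  refine ⟨min (‖μ‖ / 2) (‖μ‖ ^ 2 / 2 / (K + 1)), by positivity, fun ν hν hne => ?_⟩
  have h1 := hbd ν hν hne
  have hν0 := hν.ne_zero
  have hνn : 0 < ‖ν‖ := norm_pos_iff.2 hν0
  rcases le_or_gt (‖μ‖ / 2) (dist ν μ) with h2 | h2
  · exact (min_le_left _ _).trans h2
  · refine (min_le_right _ _).trans ?_
    have h3 : ‖μ‖ / 2 ≤ ‖ν‖ := by
      have := norm_sub_norm_le μ ν
      rw [dist_eq_norm, norm_sub_rev] at h2
      linarith
    have h4 : ‖ν⁻¹ - μ⁻¹‖ = dist ν μ / (‖ν‖ * ‖μ‖) := by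
      rw [inv_sub_inv hν0 hμ, norm_div, norm_mul, dist_eq_norm, norm_sub_rev]
    rw [h4, ← mul_div_assoc, le_div_iff₀ (by positivity)] at h1
    rw [div_le_iff₀ (by positivity)]
    have : (0:ℝ) ≤ dist ν μ := dist_nonneg
    nlinarith

end Abstract

/-! ### Primitives of integrable complex functions and the product rule. -/

section Primitives

variable {a b : ℝ}

lemma intervalIntegrable_left {f : ℝ → ℂ} (hf : IntervalIntegrable f volume a b) {x : ℝ}
    (hx : x ∈ Icc a b) : IntervalIntegrable f volume a x := by
  refine hf.mono_set ?_
  rw [uIcc_of_le hx.1, uIcc_of_le (hx.1.trans hx.2)]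
  exact Icc_subset_Icc_right hx.2

lemma continuousOn_primitive_left (hab : a ≤ b) {f : ℝ → ℂ} (hf : IntervalIntegrable f volume a b) :
    ContinuousOn (fun x => ∫ t in a..x, f t) (Icc a b) := by
  have := intervalIntegral.continuousOn_primitive_interval' hf left_mem_uIcc
  rwa [uIcc_of_le hab] at this

lemma ae_hasDerivAt_primitive (hab : a ≤ b) {f : ℝ → ℂ} (hf : IntervalIntegrable f volume a b) :
    ∀ᵐ x, x ∈ Icc a b → HasDerivAt (fun x => ∫ t in a..x, f t) (f x) x := by
  filter_upwards [hf.ae_hasDerivAt_integral] with x hx hxab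
  rw [uIcc_of_le hab] at hx
  exact hx hxab a ⟨le_rfl, hab⟩

/-- Lebesgue differentiation recovers the integrands. The null endpoints are discarded because
equality of the primitives is only known on `Icc a b`, which is a neighbourhood of its interior
points only. -/
lemma ae_eq_of_primitive_eq (hab : a ≤ b) {f g : ℝ → ℂ} (hf : IntervalIntegrable f volume a b)
    (hg : IntervalIntegrable g volume a b)
    (h : ∀ x ∈ Icc a b, ∫ t in a..x, f t = ∫ t in a..x, g t) :
    f =ᵐ[volume.restrict (Icc a b)] g := by
  rw [← restrict_Ioo_eq_restrict_Icc, Filter.EventuallyEq,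
    ae_restrict_iff' measurableSet_Ioo]
  filter_upwards [ae_hasDerivAt_primitive hab hf, ae_hasDerivAt_primitive hab hg] with x h1 h2 hx
  have hx' := Ioo_subset_Icc_self hx
  refine (h1 hx').unique ((h2 hx').congr_of_eventuallyEq ?_)
  filter_upwards [Ioo_mem_nhds hx.1 hx.2] with y hy
  exact h y (Ioo_subset_Icc_self hy)

lemma _root_.AbsolutelyContinuousOnInterval.congr_eqOn {f g : ℝ → ℂ}
    (hf : AbsolutelyContinuousOnInterval f a b) (h : EqOn f g (uIcc a b)) :
    AbsolutelyContinuousOnInterval g a b := by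
  rw [absolutelyContinuousOnInterval_iff] at hf ⊢
  intro ε hε
  obtain ⟨δ, hδ, H⟩ := hf ε hε
  refine ⟨δ, hδ, fun E hE hlt => ?_⟩
  convert H E hE hlt using 1
  refine Finset.sum_congr rfl fun i hi => ?_
  have := hE.1 i hi
  rw [h this.1, h this.2]

lemma absolutelyContinuousOnInterval_primitive (hab : a ≤ b) {f : ℝ → ℂ}
    (hf : IntervalIntegrable f volume a b) :
    AbsolutelyContinuousOnInterval (fun x => ∫ t in a..x, f t) a b := by
  have hconst (z : ℂ) : AbsolutelyContinuousOnInterval (fun _ : ℝ => z) a b :=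
    (LipschitzWith.const z).lipschitzOnWith.absolutelyContinuousOnInterval
  have hre : IntervalIntegrable (fun t => (f t).re) volume a b := ⟨hf.1.re, hf.2.re⟩
  have him : IntervalIntegrable (fun t => (f t).im) volume a b := ⟨hf.1.im, hf.2.im⟩
  have h1 := (hre.absolutelyContinuousOnInterval_intervalIntegral left_mem_uIcc).smul (hconst 1)
  have h2 := (him.absolutelyContinuousOnInterval_intervalIntegral left_mem_uIcc).smul
    (hconst Complex.I)
  have h3 := h1.add h2
  refine (h3.congr_eqOn ?_)
  symm
  intro x hx
  rw [uIcc_of_le hab] at hx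
  have hfx := intervalIntegrable_left hf hx
  have e : ∀ t, f t = ((f t).re : ℂ) * 1 + ((f t).im : ℂ) * Complex.I := fun t => by
    rw [mul_one, Complex.re_add_im]
  have hre' : IntervalIntegrable (fun t => (f t).re) volume a x := ⟨hfx.1.re, hfx.2.re⟩
  have him' : IntervalIntegrable (fun t => (f t).im) volume a x := ⟨hfx.1.im, hfx.2.im⟩
  simp only [Pi.add_apply, Pi.smul_apply', Complex.real_smul]
  rw [intervalIntegral.integral_congr (g := fun t => ((f t).re : ℂ) * 1 + ((f t).im : ℂ) * Complex.I)
    (fun t _ => e t), intervalIntegral.integral_add, intervalIntegral.integral_mul_const,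
    intervalIntegral.integral_mul_const, intervalIntegral.integral_ofReal,
    intervalIntegral.integral_ofReal]
  · exact IntervalIntegrable.mul_const ⟨hre'.1.ofReal, hre'.2.ofReal⟩ _
  · exact IntervalIntegrable.mul_const ⟨him'.1.ofReal, him'.2.ofReal⟩ _

/-- The product rule for primitives of integrable functions. -/
lemma primitive_mul_primitive (hab : a ≤ b) {F G f g : ℝ → ℂ}
    (hf : IntervalIntegrable f volume a b) (hg : IntervalIntegrable g volume a b)
    (hF : ∀ x ∈ Icc a b, F x = F a + ∫ t in a..x, f t)
    (hG : ∀ x ∈ Icc a b, G x = G a + ∫ t in a..x, g t) :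
    IntervalIntegrable (fun t => f t * G t + F t * g t) volume a b ∧
    ∀ x ∈ Icc a b, F x * G x = F a * G a + ∫ t in a..x, (f t * G t + F t * g t) := by
  have hFc : ContinuousOn F (uIcc a b) := by
    rw [uIcc_of_le hab]
    exact (continuousOn_const.add (continuousOn_primitive_left hab hf)).congr hF
  have hGc : ContinuousOn G (uIcc a b) := by
    rw [uIcc_of_le hab]
    exact (continuousOn_const.add (continuousOn_primitive_left hab hg)).congr hG
  have hint : IntervalIntegrable (fun t => f t * G t + F t * g t) volume a b :=
    (hf.mul_continuousOn hGc).add (hg.continuousOn_mul hFc)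
  refine ⟨hint, ?_⟩
  have hconst (z : ℂ) : AbsolutelyContinuousOnInterval (fun _ : ℝ => z) a b :=
    (LipschitzWith.const z).lipschitzOnWith.absolutelyContinuousOnInterval
  -- The product minus its candidate primitive is absolutely continuous with derivative zero almost
  -- everywhere, hence constant.
  have hac := (((hconst (F a)).add (absolutelyContinuousOnInterval_primitive hab hf)).smul
    ((hconst (G a)).add (absolutelyContinuousOnInterval_primitive hab hg))).sub
    (absolutelyContinuousOnInterval_primitive hab hint)
  obtain ⟨C, hC⟩ := hac.const_of_ae_hasDerivAt_zero (by
    have hab' : ∀ᵐ x : ℝ, x ≠ a ∧ x ≠ b := by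
      simp only [ne_eq, Filter.eventually_and]
      exact ⟨by simp [ae_iff, measure_singleton], by simp [ae_iff, measure_singleton]⟩
    filter_upwards [ae_hasDerivAt_primitive hab hf, ae_hasDerivAt_primitive hab hg,
      ae_hasDerivAt_primitive hab hint] with x h1 h2 h3 hx
    rw [uIcc_of_le hab] at hx
    have := (((h1 hx).const_add (F a)).mul ((h2 hx).const_add (G a))).sub (h3 hx)
    convert! this using 1
    rw [hF x hx, hG x hx]
    ring)
  rw [uIcc_of_le hab] at hC
  intro x hx
  have h1 := hC x hx
  have h2 := hC a ⟨le_rfl, hab⟩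
  simp only [Pi.sub_apply, smul_eq_mul, Pi.mul_apply, Pi.add_apply,
    intervalIntegral.integral_same, add_zero, sub_zero] at h1 h2
  rw [← hF x hx, ← hG x hx] at h1
  rw [h2, ← h1]
  ring

end Primitives

/-! ### Multiplication by continuous real functions in `L²`. -/

/-- The Hilbert space `L²([a, b], ℂ)`. -/
abbrev L2Icc (a b : ℝ) : Type := Lp ℂ 2 (volume.restrict (Icc a b))

section Multiplication

variable {a b : ℝ}

lemma exists_norm_le_of_continuousOn {k : ℝ → ℝ} (hk : ContinuousOn k (Icc a b)) :
    ∃ C : ℝ, 0 ≤ C ∧ ∀ᵐ x ∂volume.restrict (Icc a b), ‖(k x : ℂ)‖ ≤ C := by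
  obtain ⟨C, hC⟩ := isCompact_Icc.exists_bound_of_continuousOn hk
  refine ⟨max C 0, le_max_right _ _, ?_⟩
  filter_upwards [ae_restrict_mem measurableSet_Icc] with x hx
  rw [Complex.norm_real]
  exact (hC x hx).trans (le_max_left _ _)

lemma _root_.MeasureTheory.MemLp.continuousOn_mul {k : ℝ → ℝ}
    (hk : ContinuousOn k (Icc a b)) {h : ℝ → ℂ} (hh : MemLp h 2 (volume.restrict (Icc a b))) :
    MemLp (fun x => (k x : ℂ) * h x) 2 (volume.restrict (Icc a b)) := by
  obtain ⟨C, -, hC⟩ := exists_norm_le_of_continuousOn hk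
  have hkm : AEStronglyMeasurable (fun x => (k x : ℂ)) (volume.restrict (Icc a b)) :=
    (Complex.continuous_ofReal.comp_continuousOn hk).aestronglyMeasurable measurableSet_Icc
  refine hh.of_le_mul (c := C) (hkm.mul hh.1) ?_
  filter_upwards [hC] with x hx
  rw [norm_mul]
  gcongr

lemma memLp_of_continuousOn {h : ℝ → ℂ} (hh : ContinuousOn h (Icc a b)) :
    MemLp h 2 (volume.restrict (Icc a b)) := by
  obtain ⟨C, hC⟩ := isCompact_Icc.exists_bound_of_continuousOn hh
  refine MemLp.of_bound (hh.aestronglyMeasurable measurableSet_Icc) C ?_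
  filter_upwards [ae_restrict_mem measurableSet_Icc] with x hx using hC x hx

/-- Multiplication by a continuous real function, as an operator in `L²([a, b], ℂ)`. -/
noncomputable def mulL2 (k : ℝ → ℝ) (hk : ContinuousOn k (Icc a b)) : L2Icc a b →L[ℂ] L2Icc a b :=
  LinearMap.mkContinuousOfExistsBound
    { toFun := fun h => (MemLp.continuousOn_mul hk (Lp.memLp h)).toLp _
      map_add' := fun h₁ h₂ => by
        rw [← MemLp.toLp_add]
        refine MemLp.toLp_congr _ _ ?_
        filter_upwards [Lp.coeFn_add h₁ h₂] with x hx
        rw [hx, Pi.add_apply, Pi.add_apply, mul_add]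
      map_smul' := fun c h => by
        rw [RingHom.id_apply, ← MemLp.toLp_const_smul]
        refine MemLp.toLp_congr _ _ ?_
        filter_upwards [Lp.coeFn_smul c h] with x hx
        rw [hx, Pi.smul_apply, Pi.smul_apply, smul_eq_mul, smul_eq_mul]
        ring }
    (by
      obtain ⟨C, -, hC⟩ := exists_norm_le_of_continuousOn hk
      refine ⟨C, fun h => Lp.norm_le_mul_norm_of_ae_le_mul ?_⟩
      filter_upwards [hC, MemLp.coeFn_toLp (MemLp.continuousOn_mul hk (Lp.memLp h))] with x hx hx'
      simp only [LinearMap.coe_mk, AddHom.coe_mk]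
      rw [hx', norm_mul]
      gcongr)

lemma coeFn_mulL2 {k : ℝ → ℝ} (hk : ContinuousOn k (Icc a b)) (h : L2Icc a b) :
    mulL2 k hk h =ᵐ[volume.restrict (Icc a b)] fun x => (k x : ℂ) * h x :=
  MemLp.coeFn_toLp (MemLp.continuousOn_mul hk (Lp.memLp h))

lemma inner_mulL2_left {k : ℝ → ℝ} (hk : ContinuousOn k (Icc a b)) (u v : L2Icc a b) :
    (inner ℂ (mulL2 k hk u) v : ℂ) = inner ℂ u (mulL2 k hk v) := by
  rw [L2.inner_def, L2.inner_def]
  refine integral_congr_ae ?_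
  filter_upwards [coeFn_mulL2 hk u, coeFn_mulL2 hk v] with x h1 h2
  rw [h1, h2, RCLike.inner_apply, RCLike.inner_apply, map_mul, Complex.conj_ofReal]
  ring

lemma adjoint_mulL2 {k : ℝ → ℝ} (hk : ContinuousOn k (Icc a b)) :
    (mulL2 k hk).adjoint = mulL2 k hk :=
  ((ContinuousLinearMap.eq_adjoint_iff _ _).2 (inner_mulL2_left hk)).symm

end Multiplication

/-! ### The Volterra operator and its compactness. -/

section Volterra

variable {a b : ℝ}

lemma _root_.MeasureTheory.MemLp.intervalIntegrable_Icc (hab : a ≤ b) {h : ℝ → ℂ}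
    (hh : MemLp h 2 (volume.restrict (Icc a b))) : IntervalIntegrable h volume a b := by
  rw [intervalIntegrable_iff_integrableOn_Icc_of_le hab]
  exact hh.integrable (by norm_num)

/-- Cauchy-Schwarz against the indicator of `Ioc x y`. It supplies both the uniform bound and the
Hölder-1/2 modulus of continuity needed for Arzelà-Ascoli. -/
lemma norm_integral_le_sqrt_mul_norm {x y : ℝ} (hx : a ≤ x) (hxy : x ≤ y)
    (hy : y ≤ b) (h : L2Icc a b) : ‖∫ t in x..y, h t‖ ≤ √(y - x) * ‖h‖ := by
  have hsub : Ioc x y ⊆ Icc a b := fun t ht => ⟨hx.trans ht.1.le, ht.2.trans hy⟩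
  have hr : (volume.restrict (Icc a b)).restrict (Ioc x y) = volume.restrict (Ioc x y) :=
    Measure.restrict_restrict_of_subset hsub
  have hfin : (volume.restrict (Icc a b)) (Ioc x y) ≠ ⊤ := measure_ne_top _ _
  have h1 := L2.inner_indicatorConstLp_one (𝕜 := ℂ) measurableSet_Ioc hfin h
  rw [hr] at h1
  rw [intervalIntegral.integral_of_le hxy, ← h1]
  refine (norm_inner_le_norm _ _).trans ?_
  gcongr
  rw [norm_indicatorConstLp (by norm_num) (by norm_num), norm_one, one_mul, measureReal_def,
    Measure.restrict_apply measurableSet_Ioc, inter_eq_left.2 hsub, Real.volume_Ioc,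
    ENNReal.toReal_ofReal (by linarith), Real.sqrt_eq_rpow]
  simp

lemma dist_primitive_le (hab : a ≤ b) {x y : ℝ} (hx : x ∈ Icc a b) (hy : y ∈ Icc a b)
    (h : L2Icc a b) :
    dist (∫ t in a..x, h t) (∫ t in a..y, h t) ≤ √|x - y| * ‖h‖ := by
  have hi := (Lp.memLp h).intervalIntegrable_Icc hab
  wlog hxy : y ≤ x generalizing x y
  · rw [dist_comm, abs_sub_comm]
    exact this hy hx (le_of_not_ge hxy)
  rw [dist_eq_norm, intervalIntegral.integral_interval_sub_left (intervalIntegrable_left hi hx)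
    (intervalIntegrable_left hi hy), abs_of_nonneg (sub_nonneg.2 hxy)]
  exact norm_integral_le_sqrt_mul_norm hy.1 hxy hx.2 h

/-- The primitive of an `L²` function, as an operator into the continuous functions. -/
noncomputable def primitiveCLM (hab : a ≤ b) :
    L2Icc a b →L[ℂ] BoundedContinuousFunction (Icc a b) ℂ :=
  LinearMap.mkContinuous
    { toFun := fun h => BoundedContinuousFunction.mkOfCompact
        ⟨fun x => ∫ t in a..x, h t, continuousOn_iff_continuous_domRestrict.1
          (continuousOn_primitive_left hab ((Lp.memLp h).intervalIntegrable_Icc hab))⟩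
      map_add' := fun h₁ h₂ => by
        ext x
        change ∫ t in a..x, (h₁ + h₂ : L2Icc a b) t = (∫ t in a..x, h₁ t) + ∫ t in a..x, h₂ t
        rw [← intervalIntegral.integral_add
          (intervalIntegrable_left ((Lp.memLp h₁).intervalIntegrable_Icc hab) x.2)
          (intervalIntegrable_left ((Lp.memLp h₂).intervalIntegrable_Icc hab) x.2)]
        refine intervalIntegral.integral_congr_ae_restrict ?_
        refine ae_restrict_of_ae_restrict_of_subset ?_ (Lp.coeFn_add h₁ h₂)
        rw [uIoc_of_le x.2.1]
        exact fun t ht => ⟨ht.1.le, ht.2.trans x.2.2⟩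
      map_smul' := fun c h => by
        ext x
        change ∫ t in a..x, (c • h : L2Icc a b) t = c • ∫ t in a..x, h t
        rw [← intervalIntegral.integral_smul]
        refine intervalIntegral.integral_congr_ae_restrict ?_
        refine ae_restrict_of_ae_restrict_of_subset ?_ (Lp.coeFn_smul c h)
        rw [uIoc_of_le x.2.1]
        exact fun t ht => ⟨ht.1.le, ht.2.trans x.2.2⟩ }
    (√(b - a)) (fun h => by
      rw [BoundedContinuousFunction.norm_le (by positivity)]
      intro x
      refine (norm_integral_le_sqrt_mul_norm le_rfl x.2.1 x.2.2 h).trans ?_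
      gcongr
      exact x.2.2)

lemma isCompactOperator_primitiveCLM (hab : a ≤ b) : IsCompactOperator (primitiveCLM hab) := by
  refine (isCompactOperator_iff_isCompact_closure_image_closedBall
    (primitiveCLM hab).toLinearMap zero_lt_one).2 ?_
  refine BoundedContinuousFunction.arzela_ascoli (Metric.closedBall 0 (√(b - a)))
    (isCompact_closedBall _ _) _ ?_ ?_
  · rintro f x ⟨h, hh, rfl⟩
    rw [mem_closedBall_zero_iff] at hh ⊢
    refine (norm_integral_le_sqrt_mul_norm le_rfl x.2.1 x.2.2 h).trans ?_
    calc √(x - a) * ‖h‖ ≤ √(b - a) * 1 := by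
          gcongr
          exact x.2.2
      _ = _ := mul_one _
  · refine Metric.equicontinuous_of_continuity_modulus (fun r => √r) ?_ _ ?_
    · have := Real.continuous_sqrt.tendsto 0
      rwa [Real.sqrt_zero] at this
    · rintro x y ⟨f, h, hh, rfl⟩
      rw [mem_closedBall_zero_iff] at hh
      refine (dist_primitive_le hab x.2 y.2 h).trans ?_
      rw [Subtype.dist_eq, Real.dist_eq]
      exact mul_le_of_le_one_right (Real.sqrt_nonneg _) hh

/-- Continuous functions on `[a, b]` as elements of `L²([a, b], ℂ)`. -/
noncomputable def continuousToL2 (hab : a ≤ b) :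
    BoundedContinuousFunction (Icc a b) ℂ →L[ℂ] L2Icc a b :=
  (BoundedContinuousFunction.toLp 2 (volume.restrict (Icc a b)) ℂ).comp
    (LinearMap.mkContinuous
      ({ toFun := fun f => f.compContinuous ⟨projIcc a b hab, continuous_projIcc⟩
         map_add' := fun _ _ => rfl
         map_smul' := fun _ _ => rfl } :
        BoundedContinuousFunction (Icc a b) ℂ →ₗ[ℂ] BoundedContinuousFunction ℝ ℂ) 1 (fun f => by
        rw [one_mul, BoundedContinuousFunction.norm_le (norm_nonneg _)]
        exact fun x => f.norm_coe_le_norm _))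

/-- The Volterra operator `h ↦ ∫ₐˣ h` in `L²([a, b], ℂ)`. -/
noncomputable def volterra (hab : a ≤ b) : L2Icc a b →L[ℂ] L2Icc a b :=
  (continuousToL2 hab).comp (primitiveCLM hab)

lemma isCompactOperator_volterra (hab : a ≤ b) : IsCompactOperator (volterra hab) :=
  (isCompactOperator_primitiveCLM hab).clm_comp (continuousToL2 hab)

lemma coeFn_volterra (hab : a ≤ b) (h : L2Icc a b) :
    volterra hab h =ᵐ[volume.restrict (Icc a b)] fun x => ∫ t in a..x, h t := by
  refine (BoundedContinuousFunction.coeFn_toLp (p := 2) (E := ℂ) (𝕜 := ℂ)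
    (volume.restrict (Icc a b)) ((primitiveCLM hab h).compContinuous
      ⟨projIcc a b hab, continuous_projIcc⟩)).trans ?_
  filter_upwards [ae_restrict_mem measurableSet_Icc] with x hx
  change ∫ t in a..(projIcc a b hab x : ℝ), h t = _
  rw [projIcc_of_mem hab hx]

end Volterra

/-! ### The Dirichlet solution operator as `-B B*`. -/

section Operator

variable {a b : ℝ}

lemma integral_congr_left {f g : ℝ → ℂ} (h : f =ᵐ[volume.restrict (Icc a b)] g) {x : ℝ}
    (hx : x ∈ Icc a b) : ∫ t in a..x, f t = ∫ t in a..x, g t := by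
  refine intervalIntegral.integral_congr_ae_restrict ?_
  refine ae_restrict_of_ae_restrict_of_subset ?_ h
  rw [uIoc_of_le hx.1]
  exact fun t ht => ⟨ht.1.le, ht.2.trans hx.2⟩

lemma inner_L2_eq_integral (hab : a ≤ b) (u v : L2Icc a b) :
    (inner ℂ u v : ℂ) = ∫ x in a..b, (starRingEnd ℂ) (u x) * v x := by
  rw [L2.inner_def, intervalIntegral.integral_of_le hab, ← integral_Icc_eq_integral_Ioc]
  refine integral_congr_ae (Filter.Eventually.of_forall fun x => ?_)
  simp only [RCLike.inner_apply, mul_comm]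

lemma intervalIntegrable_conj {f : ℝ → ℂ} (hf : IntervalIntegrable f volume a b) :
    IntervalIntegrable (fun t => (starRingEnd ℂ) (f t)) volume a b :=
  ⟨(Complex.conjLIE.toContinuousLinearEquiv.toContinuousLinearMap).integrable_comp hf.1,
    (Complex.conjLIE.toContinuousLinearEquiv.toContinuousLinearMap).integrable_comp hf.2⟩

/-- A real function that is continuous on `[a, b]`, as an element of `L²([a, b], ℂ)`. -/
noncomputable def ofContinuousOn (k : ℝ → ℝ) (hk : ContinuousOn k (Icc a b)) : L2Icc a b :=
  (memLp_of_continuousOn (Complex.continuous_ofReal.comp_continuousOn hk)).toLp _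

lemma coeFn_ofContinuousOn {k : ℝ → ℝ} (hk : ContinuousOn k (Icc a b)) :
    ofContinuousOn k hk =ᵐ[volume.restrict (Icc a b)] fun x => (k x : ℂ) :=
  MemLp.coeFn_toLp (memLp_of_continuousOn (Complex.continuous_ofReal.comp_continuousOn hk))

/-- Integration by parts: `∫ₐˣ h` vanishes at `a`, and the primitive of `k` is normalized by `-c` so
as to vanish at `b`, hence there are no boundary terms. -/
lemma adjoint_volterra_apply (hab : a ≤ b) (k : L2Icc a b) :
    (volterra hab).adjoint k =
      (∫ t in a..b, k t) • ofContinuousOn (fun _ => 1) continuousOn_const - volterra hab k := by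
  refine ext_inner_left ℂ fun h => ?_
  rw [ContinuousLinearMap.adjoint_inner_right, inner_L2_eq_integral hab,
    inner_L2_eq_integral hab]
  have hh := (Lp.memLp h).intervalIntegrable_Icc hab
  have hk := (Lp.memLp k).intervalIntegrable_Icc hab
  have hbb : b ∈ Icc a b := ⟨hab, le_rfl⟩
  set c := ∫ t in a..b, k t with hc
  obtain ⟨hint, hmul⟩ := primitive_mul_primitive hab
    (F := fun x => (starRingEnd ℂ) (∫ t in a..x, h t)) (G := fun x => (∫ t in a..x, k t) - c)
    (f := fun t => (starRingEnd ℂ) (h t)) (g := fun t => k t) (intervalIntegrable_conj hh) hk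
    (fun x hx => by
      rw [intervalIntegral.integral_same, map_zero, zero_add,
        intervalIntegral.integral_of_le hx.1, intervalIntegral.integral_of_le hx.1, integral_conj])
    (fun x _ => by
      rw [intervalIntegral.integral_same]
      ring)
  have h0 := hmul b hbb
  simp only [intervalIntegral.integral_same, map_zero, zero_mul, zero_add] at h0
  rw [← hc, sub_self, mul_zero] at h0
  have h1 : (fun x => (starRingEnd ℂ) (volterra hab h x) * k x)
      =ᵐ[volume.restrict (Icc a b)] fun x => (starRingEnd ℂ) (∫ t in a..x, h t) * k x := by
    filter_upwards [coeFn_volterra hab h] with x hx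
    rw [hx]
  have h2 : (fun x => (starRingEnd ℂ) (h x) *
      (c • ofContinuousOn (fun _ => 1) continuousOn_const - volterra hab k : L2Icc a b) x)
      =ᵐ[volume.restrict (Icc a b)]
      fun x => -((starRingEnd ℂ) (h x) * ((∫ t in a..x, k t) - c)) := by
    filter_upwards [coeFn_volterra hab k, Lp.coeFn_sub
      (c • ofContinuousOn (fun _ => 1) continuousOn_const) (volterra hab k),
      Lp.coeFn_smul c (ofContinuousOn (a := a) (b := b) (fun _ => 1) continuousOn_const),
      coeFn_ofContinuousOn (a := a) (b := b) (k := fun _ => 1) continuousOn_const] with x h1 h2 h3 h4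
    rw [h2, Pi.sub_apply, h3, Pi.smul_apply, h4, h1, smul_eq_mul, Complex.ofReal_one]
    ring
  rw [integral_congr_left h1 hbb, integral_congr_left h2 hbb, intervalIntegral.integral_neg]
  have hF : ContinuousOn (fun x => (starRingEnd ℂ) (∫ t in a..x, h t)) (uIcc a b) := by
    rw [uIcc_of_le hab]
    exact Complex.continuous_conj.comp_continuousOn (continuousOn_primitive_left hab hh)
  have hG : ContinuousOn (fun x => (∫ t in a..x, k t) - c) (uIcc a b) := by
    rw [uIcc_of_le hab]
    exact (continuousOn_primitive_left hab hk).sub continuousOn_const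
  rw [intervalIntegral.integral_add ((intervalIntegrable_conj hh).mul_continuousOn hG)
    (hk.continuousOn_mul hF)] at h0
  rw [eq_neg_iff_add_eq_zero, h0, add_comm]

/-- The Volterra operator with the weights `s` and `e`, on the orthogonal complement of `e`. -/
noncomputable def sturmFactor (hab : a ≤ b) (e s : ℝ → ℝ) (he : ContinuousOn e (Icc a b))
    (hs : ContinuousOn s (Icc a b)) : L2Icc a b →L[ℂ] L2Icc a b :=
  mulL2 s hs ∘L (volterra hab ∘L (mulL2 e he ∘L
    (Submodule.span ℂ {ofContinuousOn e he})ᗮ.starProjection))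

/-- For continuous `e` and `s`, the solution operator of `((u / s)' / e²)' = s v` with
`u(a) = u(b) = 0`. It is `-B B*`, where `B` is `sturmFactor`. -/
noncomputable def sturmOp (hab : a ≤ b) (e s : ℝ → ℝ) (he : ContinuousOn e (Icc a b))
    (hs : ContinuousOn s (Icc a b)) : L2Icc a b →L[ℂ] L2Icc a b :=
  -(sturmFactor hab e s he hs ∘L (sturmFactor hab e s he hs).adjoint)

variable (hab : a ≤ b) {e s : ℝ → ℝ} (he : ContinuousOn e (Icc a b)) (hs : ContinuousOn s (Icc a b))

lemma isCompactOperator_sturmOp : IsCompactOperator (sturmOp hab e s he hs) := by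
  have h1 : IsCompactOperator (sturmFactor hab e s he hs) :=
    ((isCompactOperator_volterra hab).comp_clm (mulL2 e he ∘L
      (Submodule.span ℂ {ofContinuousOn e he})ᗮ.starProjection)).clm_comp (mulL2 s hs)
  exact (h1.comp_clm (sturmFactor hab e s he hs).adjoint).neg

lemma inner_sturmOp (u v : L2Icc a b) : (inner ℂ (sturmOp hab e s he hs u) v : ℂ) =
    -inner ℂ ((sturmFactor hab e s he hs).adjoint u) ((sturmFactor hab e s he hs).adjoint v) := by
  rw [sturmOp, neg_apply, inner_neg_left, ContinuousLinearMap.comp_apply,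
    ContinuousLinearMap.adjoint_inner_right]

lemma isSymmetric_sturmOp : (sturmOp hab e s he hs).IsSymmetric := by
  intro u v
  have h1 := inner_sturmOp hab he hs u v
  have h2 := inner_sturmOp hab he hs v u
  change (inner ℂ (sturmOp hab e s he hs u) v : ℂ) = inner ℂ u (sturmOp hab e s he hs v)
  rw [← inner_conj_symm u, h2, h1, map_neg, inner_conj_symm]

lemma re_inner_sturmOp_nonpos (u : L2Icc a b) :
    (inner ℂ (sturmOp hab e s he hs u) u : ℂ).re ≤ 0 := by
  rw [inner_sturmOp, Complex.neg_re, neg_nonpos]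
  exact inner_self_nonneg (𝕜 := ℂ)

lemma mulL2_one : mulL2 e he (ofContinuousOn (fun _ => 1) continuousOn_const) =
    ofContinuousOn e he := by
  refine Lp.ext ?_
  filter_upwards [coeFn_mulL2 he (ofContinuousOn (fun _ => 1) continuousOn_const),
    coeFn_ofContinuousOn he,
    coeFn_ofContinuousOn (a := a) (b := b) (k := fun _ => 1) continuousOn_const] with x h1 h2 h3
  rw [h1, h2, h3, Complex.ofReal_one, mul_one]

/-- The adjoint of `volterra` differs from `-volterra` by a constant function; multiplication by `e`
turns this into a multiple of `e`, which the projection onto `e^⊥` annihilates. This is why the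
projection belongs in `sturmFactor`. -/
lemma adjoint_sturmFactor_apply (v : L2Icc a b) : (sturmFactor hab e s he hs).adjoint v =
    -(Submodule.span ℂ {ofContinuousOn e he})ᗮ.starProjection
      (mulL2 e he (volterra hab (mulL2 s hs v))) := by
  have hQ : (Submodule.span ℂ {ofContinuousOn e he})ᗮ.starProjection (ofContinuousOn e he) = 0 := by
    rw [Submodule.starProjection_apply_eq_zero_iff]
    exact Submodule.le_orthogonal_orthogonal _ (Submodule.mem_span_singleton_self _)
  have hsa : ((Submodule.span ℂ {ofContinuousOn e he})ᗮ.starProjection).adjoint =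
    (Submodule.span ℂ {ofContinuousOn e he})ᗮ.starProjection :=
    (isSelfAdjoint_starProjection _).adjoint_eq
  rw [sturmFactor, ContinuousLinearMap.adjoint_comp, ContinuousLinearMap.adjoint_comp,
    ContinuousLinearMap.adjoint_comp, adjoint_mulL2, adjoint_mulL2, hsa]
  simp only [ContinuousLinearMap.comp_apply]
  rw [adjoint_volterra_apply, map_sub, map_sub, map_smul, map_smul, mulL2_one, hQ, smul_zero,
    zero_sub]

lemma sturmOp_apply (v : L2Icc a b) : sturmOp hab e s he hs v =
    mulL2 s hs (volterra hab (mulL2 e he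
      ((Submodule.span ℂ {ofContinuousOn e he})ᗮ.starProjection
        (mulL2 e he (volterra hab (mulL2 s hs v)))))) := by
  rw [sturmOp, neg_apply, ContinuousLinearMap.comp_apply, adjoint_sturmFactor_apply, map_neg,
    neg_neg, sturmFactor]
  simp only [ContinuousLinearMap.comp_apply]
  congr 3
  exact Submodule.starProjection_eq_self_iff.2 (Submodule.starProjection_apply_mem _ _)

lemma coeFn_volterra_mulL2 (v : L2Icc a b) :
    volterra hab (mulL2 s hs v) =ᵐ[volume.restrict (Icc a b)]
      fun x => ∫ t in a..x, (s t : ℂ) * v t := by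
  filter_upwards [coeFn_volterra hab (mulL2 s hs v), ae_restrict_mem measurableSet_Icc] with x h1 hx
  rw [h1, integral_congr_left (coeFn_mulL2 hs v) hx]

/-- The pointwise form of `sturmOp`. -/
lemma coeFn_sturmOp (v : L2Icc a b) {c : ℂ}
    (hc : ∫ x in a..b, (e x : ℂ) ^ 2 * (c + ∫ t in a..x, (s t : ℂ) * v t) = 0) :
    sturmOp hab e s he hs v =ᵐ[volume.restrict (Icc a b)]
      fun x => (s x : ℂ) * ∫ t in a..x, (e t : ℂ) ^ 2 * (c + ∫ r in a..t, (s r : ℂ) * v r) := by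
  set y := mulL2 e he (volterra hab (mulL2 s hs v)) with hy
  -- Condition `hc`, which says that the inner integral of the solution vanishes at `b`, is exactly
  -- `z ⟂ e`. As `z - y` is a multiple of `e`, the projection of `y` onto `e^⊥` is `z`: the
  -- projection chooses the constant that enforces the right boundary condition.
  set z := y + c • ofContinuousOn e he with hz
  have hzx : z =ᵐ[volume.restrict (Icc a b)]
      fun x => (e x : ℂ) * (c + ∫ r in a..x, (s r : ℂ) * v r) := by
    filter_upwards [Lp.coeFn_add y (c • ofContinuousOn e he),
      Lp.coeFn_smul c (ofContinuousOn e he), coeFn_ofContinuousOn he,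
      coeFn_mulL2 he (volterra hab (mulL2 s hs v)), coeFn_volterra_mulL2 hab hs v]
      with x h1 h2 h3 h4 h5
    rw [hz, h1, Pi.add_apply, h2, Pi.smul_apply, h3, hy, h4, h5, smul_eq_mul]
    ring
  have hQ : (Submodule.span ℂ {ofContinuousOn e he})ᗮ.starProjection y = z := by
    refine Submodule.eq_starProjection_of_mem_orthogonal' (z := (-c) • ofContinuousOn e he) ?_ ?_ ?_
    · rw [Submodule.mem_orthogonal_singleton_iff_inner_right, inner_L2_eq_integral hab, ← hc]
      refine integral_congr_left ?_ ⟨hab, le_rfl⟩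
      filter_upwards [hzx, coeFn_ofContinuousOn he] with x h1 h2
      rw [h1, h2, Complex.conj_ofReal]
      ring
    · exact Submodule.smul_mem _ _
        (Submodule.le_orthogonal_orthogonal _ (Submodule.mem_span_singleton_self _))
    · rw [hz]
      module
  rw [sturmOp_apply, hQ]
  filter_upwards [coeFn_mulL2 hs (volterra hab (mulL2 e he z)), coeFn_volterra_mulL2 hab he z,
    ae_restrict_mem measurableSet_Icc] with x h1 h2 hx
  rw [h1, h2]
  congr 1
  refine integral_congr_left ?_ hx
  filter_upwards [hzx] with t ht
  rw [ht]
  ring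

end Operator

/-! ### Injectivity of the solution operator for positive weights, and infinite dimension of `L²`.
-/

section Positive

variable {a b : ℝ}

lemma intervalIntegrable_continuousOn_mul (hab : a ≤ b) {k : ℝ → ℝ} (hk : ContinuousOn k (Icc a b))
    (v : L2Icc a b) : IntervalIntegrable (fun t => (k t : ℂ) * v t) volume a b :=
  (MemLp.continuousOn_mul hk (Lp.memLp v)).intervalIntegrable_Icc hab

lemma continuousOn_sturm_integrand (hab : a ≤ b) {e s : ℝ → ℝ}
    (he : ContinuousOn e (Icc a b)) (hs : ContinuousOn s (Icc a b)) (v : L2Icc a b) (c : ℂ) :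
    ContinuousOn (fun x => (e x : ℂ) ^ 2 * (c + ∫ t in a..x, (s t : ℂ) * v t)) (Icc a b) :=
  ((Complex.continuous_ofReal.comp_continuousOn he).pow 2).mul
    (continuousOn_const.add
      (continuousOn_primitive_left hab (intervalIntegrable_continuousOn_mul hab hs v)))

/-- The condition is affine in `c` with slope `∫ e² > 0`, so it can be solved for `c`. -/
lemma exists_sturm_const (hab : a < b) {e s : ℝ → ℝ} (he : ContinuousOn e (Icc a b))
    (hs : ContinuousOn s (Icc a b)) (hepos : ∀ x ∈ Icc a b, 0 < e x) (v : L2Icc a b) :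
    ∃ c : ℂ, ∫ x in a..b, (e x : ℂ) ^ 2 * (c + ∫ t in a..x, (s t : ℂ) * v t) = 0 := by
  have h1 : 0 < ∫ x in a..b, e x ^ 2 := by
    refine intervalIntegral.intervalIntegral_pos_of_pos_on ?_ ?_ hab
    · exact (he.pow 2).intervalIntegrable_of_Icc hab.le
    · intro x hx
      have := hepos x (Ioo_subset_Icc_self hx)
      positivity
  have h2 : (∫ x in a..b, (e x : ℂ) ^ 2) ≠ 0 := by
    have : (∫ x in a..b, (e x : ℂ) ^ 2) = ((∫ x in a..b, e x ^ 2 : ℝ) : ℂ) := by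
      rw [← intervalIntegral.integral_ofReal]
      simp
    rw [this]
    exact_mod_cast h1.ne'
  have hi : IntervalIntegrable (fun x => (e x : ℂ) ^ 2 * ∫ t in a..x, (s t : ℂ) * v t) volume a b := by
    have := continuousOn_sturm_integrand hab.le he hs v 0
    simp only [zero_add] at this
    exact this.intervalIntegrable_of_Icc hab.le
  refine ⟨-(∫ x in a..b, (e x : ℂ) ^ 2 * ∫ t in a..x, (s t : ℂ) * v t) /
    ∫ x in a..b, (e x : ℂ) ^ 2, ?_⟩
  simp_rw [mul_add]
  rw [intervalIntegral.integral_add _ hi, intervalIntegral.integral_mul_const,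
    mul_div_cancel₀ _ h2]
  · ring
  · exact ((Complex.continuous_ofReal.comp_continuousOn he).pow 2).mul continuousOn_const
      |>.intervalIntegrable_of_Icc hab.le

/-- The two integrations in `coeFn_sturmOp` are undone one after the other, dividing by the positive
weights; evaluation at `a` shows in between that `c = 0`. -/
lemma eq_zero_of_sturmOp_eq_zero (hab : a < b) {e s : ℝ → ℝ} (he : ContinuousOn e (Icc a b))
    (hs : ContinuousOn s (Icc a b)) (hepos : ∀ x ∈ Icc a b, 0 < e x)
    (hspos : ∀ x ∈ Icc a b, 0 < s x) {v : L2Icc a b} (h : sturmOp hab.le e s he hs v = 0) : v = 0 := by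
  obtain ⟨c, hc⟩ := exists_sturm_const hab he hs hepos v
  have h1 := coeFn_sturmOp hab.le he hs v hc
  rw [h] at h1
  have hcont := continuousOn_sturm_integrand hab.le he hs v c
  have hint := hcont.intervalIntegrable_of_Icc (μ := volume) hab.le
  have hz : ∀ x ∈ Icc a b,
      (s x : ℂ) * ∫ t in a..x, (e t : ℂ) ^ 2 * (c + ∫ r in a..t, (s r : ℂ) * v r) = 0 := by
    refine Measure.eqOn_Icc_of_ae_eq volume hab.ne ?_
      ((Complex.continuous_ofReal.comp_continuousOn hs).mul
        (continuousOn_primitive_left hab.le hint)) continuousOn_const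
    filter_upwards [h1, Lp.coeFn_zero ℂ 2 (volume.restrict (Icc a b))] with x hx h0
    rw [← hx, h0, Pi.zero_apply]
  have h2 : (fun t => (e t : ℂ) ^ 2 * (c + ∫ r in a..t, (s r : ℂ) * v r))
      =ᵐ[volume.restrict (Icc a b)] fun _ => (0 : ℂ) := by
    refine ae_eq_of_primitive_eq hab.le hint (by simp) fun x hx => ?_
    rw [intervalIntegral.integral_zero]
    exact (mul_eq_zero.1 (hz x hx)).resolve_left (by exact_mod_cast (hspos x hx).ne')
  have h3 := Measure.eqOn_Icc_of_ae_eq volume hab.ne h2 hcont continuousOn_const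
  have h4 : ∀ x ∈ Icc a b, c + ∫ r in a..x, (s r : ℂ) * v r = 0 := fun x hx =>
    (mul_eq_zero.1 (h3 hx)).resolve_left (pow_ne_zero _ (by exact_mod_cast (hepos x hx).ne'))
  have hc0 : c = 0 := by
    have := h4 a ⟨le_rfl, hab.le⟩
    rwa [intervalIntegral.integral_same, add_zero] at this
  have h5 : (fun t => (s t : ℂ) * v t) =ᵐ[volume.restrict (Icc a b)] fun _ => (0 : ℂ) := by
    refine ae_eq_of_primitive_eq hab.le (intervalIntegrable_continuousOn_mul hab.le hs v) (by simp)
      fun x hx => ?_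
    rw [intervalIntegral.integral_zero, ← h4 x hx, hc0, zero_add]
  refine (Lp.eq_zero_iff_ae_eq_zero).2 ?_
  filter_upwards [h5, ae_restrict_mem measurableSet_Icc] with x hx hm
  exact (mul_eq_zero.1 hx).resolve_left (by exact_mod_cast (hspos x hm).ne')

/-- In finite dimension the injective operator `volterra` would be surjective, but primitives vanish
at `a`, so the constant `1` is not in its range. -/
lemma not_finiteDimensional_L2Icc (hab : a < b) : ¬ FiniteDimensional ℂ (L2Icc a b) := by
  intro hfd
  have hinj : Function.Injective (volterra hab.le).toLinearMap := by
    rw [injective_iff_map_eq_zero]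
    intro v hv
    have hi := (Lp.memLp v).intervalIntegrable_Icc hab.le
    have h1 := coeFn_volterra hab.le v
    rw [show volterra hab.le v = 0 from hv] at h1
    have h2 := Measure.eqOn_Icc_of_ae_eq volume hab.ne
      (h1.symm.trans (Lp.coeFn_zero ℂ 2 (volume.restrict (Icc a b))))
      (continuousOn_primitive_left hab.le hi) continuousOn_const
    refine (Lp.eq_zero_iff_ae_eq_zero).2 (ae_eq_of_primitive_eq (g := fun _ => 0) hab.le hi
      (by simp) fun x hx => ?_)
    rw [intervalIntegral.integral_zero]
    exact h2 hx
  obtain ⟨v, hv⟩ := (LinearMap.injective_iff_surjective.1 hinj)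
    (ofContinuousOn (fun _ => 1) continuousOn_const)
  have h1 := coeFn_volterra hab.le v
  rw [show volterra hab.le v = _ from hv] at h1
  have h2 := Measure.eqOn_Icc_of_ae_eq volume hab.ne
    (h1.symm.trans (coeFn_ofContinuousOn (a := a) (b := b) (k := fun _ => 1) continuousOn_const))
    (continuousOn_primitive_left hab.le ((Lp.memLp v).intervalIntegrable_Icc hab.le))
    continuousOn_const
  have := h2 (show a ∈ Icc a b from ⟨le_rfl, hab.le⟩)
  simp at this

end Positive

/-! ### Uniqueness for the initial value problem and one-dimensional eigenspaces. -/

section Uniqueness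

variable {a b : ℝ}

lemma hasDerivWithinAt_primitive {f : ℝ → ℂ} (hf : ContinuousOn f (Icc a b)) {x : ℝ}
    (hx : x ∈ Ico a b) : HasDerivWithinAt (fun x => ∫ t in a..x, f t) (f x) (Ici x) x := by
  have hab : a ≤ b := hx.1.trans hx.2.le
  have hmem : Icc a b ∈ nhdsWithin x (Ioi x) :=
    Filter.mem_of_superset (Ioo_mem_nhdsGT hx.2) fun t ht => ⟨hx.1.trans ht.1.le, ht.2.le⟩
  refine intervalIntegral.integral_hasDerivWithinAt_right (s := Ici x) (t := Ioi x)
    (intervalIntegrable_left (hf.intervalIntegrable_of_Icc hab) ⟨hx.1, hx.2.le⟩) ?_ ?_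
  · exact ⟨Icc a b, hmem, hf.aestronglyMeasurable measurableSet_Icc⟩
  · exact (hf x ⟨hx.1, hx.2.le⟩).mono_of_mem_nhdsWithin hmem

/-- Uniqueness for the initial value problem `P' = α R`, `R' = β P`, `P(a) = R(a) = 0`. -/
lemma eq_zero_of_linear_system {α β P R : ℝ → ℂ} (hα : ContinuousOn α (Icc a b))
    (hβ : ContinuousOn β (Icc a b)) (hPc : ContinuousOn P (Icc a b)) (hRc : ContinuousOn R (Icc a b))
    (hP : ∀ x ∈ Icc a b, P x = ∫ t in a..x, α t * R t)
    (hR : ∀ x ∈ Icc a b, R x = ∫ t in a..x, β t * P t) : ∀ x ∈ Icc a b, P x = 0 := by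
  obtain ⟨C, hC⟩ := isCompact_Icc.exists_bound_of_continuousOn hα
  obtain ⟨D, hD⟩ := isCompact_Icc.exists_bound_of_continuousOn hβ
  intro x hx
  have haa : a ∈ Icc a b := ⟨le_rfl, hx.1.trans hx.2⟩
  have hd (x) (hx : x ∈ Ico a b) :
      HasDerivWithinAt (fun x => (P x, R x)) (α x * R x, β x * P x) (Ici x) x := by
    have hx' : x ∈ Icc a b := ⟨hx.1, hx.2.le⟩
    have hev : ∀ᶠ y in nhdsWithin x (Ici x), y ∈ Icc a b :=
      Filter.mem_of_superset (Ico_mem_nhdsGE hx.2) fun t ht => ⟨hx.1.trans ht.1, ht.2.le⟩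
    exact ((hasDerivWithinAt_primitive (hα.mul hRc) hx).congr_of_eventuallyEq
        (hev.mono hP) (hP x hx')).prodMk
      ((hasDerivWithinAt_primitive (hβ.mul hPc) hx).congr_of_eventuallyEq
        (hev.mono hR) (hR x hx'))
  -- Grönwall for the pair in the maximum norm, with rate `max C D`; zero initial value and zero
  -- inhomogeneity make the bound vanish.
  have h := norm_le_gronwallBound_of_norm_deriv_right_le (f := fun x => (P x, R x))
    (δ := 0) (K := max C D) (ε := 0) (hPc.prodMk hRc) hd
    (by simp [hP a haa, hR a haa]) (fun x hx => by
      have hx' : x ∈ Icc a b := ⟨hx.1, hx.2.le⟩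
      rw [add_zero, Prod.norm_def, Prod.norm_def]
      have h0 : 0 ≤ ‖P x‖ := norm_nonneg _
      have h1 : 0 ≤ max C D := (norm_nonneg _).trans ((hC x hx').trans (le_max_left _ _))
      refine max_le ?_ ?_
      · rw [norm_mul]
        exact mul_le_mul ((hC x hx').trans (le_max_left _ _)) (le_max_right _ _)
          (norm_nonneg _) h1
      · rw [norm_mul]
        exact mul_le_mul ((hD x hx').trans (le_max_right _ _)) (le_max_left _ _)
          (norm_nonneg _) h1) x hx
  rw [gronwallBound_ε0_δ0] at h
  have := (norm_le_zero_iff.1 h)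
  exact congrArg Prod.fst this

variable (hab : a < b) {e s : ℝ → ℝ} (he : ContinuousOn e (Icc a b))
  (hs : ContinuousOn s (Icc a b))

/-- Here `hc` says that the constant in `coeFn_sturmOp` can be taken to be `0`. Then `R = ∫ s u` and
`P = ∫ e² R` have zero initial values at `a` and satisfy `P' = e² R`, `R' = μ s² P`, so they vanish.
-/
lemma eq_zero_of_sturm_const_eq_zero {μ : ℂ} {u : L2Icc a b}
    (hu : u = μ • sturmOp hab.le e s he hs u)
    (hc : ∫ x in a..b, (e x : ℂ) ^ 2 * (∫ t in a..x, (s t : ℂ) * u t) = 0) : u = 0 := by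
  have h1 := coeFn_sturmOp hab.le he hs u (c := 0) (by simpa using hc)
  simp only [zero_add] at h1
  have hsu := intervalIntegrable_continuousOn_mul hab.le hs u
  set R : ℝ → ℂ := fun x => ∫ t in a..x, (s t : ℂ) * u t with hRdef
  have hRc : ContinuousOn R (Icc a b) := continuousOn_primitive_left hab.le hsu
  have he' := (Complex.continuous_ofReal.comp_continuousOn he).pow 2
  have hs' := (Complex.continuous_ofReal.comp_continuousOn hs)
  set P : ℝ → ℂ := fun x => ∫ t in a..x, (e t : ℂ) ^ 2 * R t with hPdef
  have hPc : ContinuousOn P (Icc a b) :=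
    continuousOn_primitive_left hab.le ((he'.mul hRc).intervalIntegrable_of_Icc hab.le)
  have hu2 : u =ᵐ[volume.restrict (Icc a b)] fun x => μ * ((s x : ℂ) * P x) := by
    have h2 := Lp.coeFn_smul μ (sturmOp hab.le e s he hs u)
    rw [← hu] at h2
    filter_upwards [h1, h2] with x h1 h2
    rw [h2, Pi.smul_apply, h1, smul_eq_mul]
  have hP0 := eq_zero_of_linear_system (α := fun t => (e t : ℂ) ^ 2)
    (β := fun t => μ * (s t : ℂ) ^ 2) he' (continuousOn_const.mul (hs'.pow 2)) hPc hRc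
    (fun _ _ => rfl) (fun x hx => by
      refine integral_congr_left ?_ hx
      filter_upwards [hu2] with t ht
      rw [ht]
      ring)
  refine (Lp.eq_zero_iff_ae_eq_zero).2 ?_
  filter_upwards [hu2, ae_restrict_mem measurableSet_Icc] with x hx hm
  rw [hx, hP0 x hm, mul_zero, mul_zero, Pi.zero_apply]

/-- The eigenspaces of a Sturm-Liouville operator are at most one-dimensional. -/
lemma exists_smul_eq_of_sturm (hepos : ∀ x ∈ Icc a b, 0 < e x) {μ : ℂ} {u u₀ : L2Icc a b}
    (hu : u = μ • sturmOp hab.le e s he hs u) (hu₀ : u₀ = μ • sturmOp hab.le e s he hs u₀)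
    (h0 : u₀ ≠ 0) : ∃ c : ℂ, u = c • u₀ := by
  obtain ⟨c, hc⟩ := exists_sturm_const hab he hs hepos u
  obtain ⟨c₀, hc₀⟩ := exists_sturm_const hab he hs hepos u₀
  have hc0 : c₀ ≠ 0 := by
    rintro rfl
    refine h0 (eq_zero_of_sturm_const_eq_zero hab he hs hu₀ ?_)
    simpa using hc₀
  -- The constant depends linearly on the solution, and for `u - (c / c₀) • u₀` it is `c - (c / c₀)
  -- * c₀ = 0`.
  refine ⟨c / c₀, sub_eq_zero.1 (eq_zero_of_sturm_const_eq_zero hab he hs (μ := μ) ?_ ?_)⟩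
  · rw [map_sub, map_smul, smul_sub, ← hu, smul_comm, ← hu₀]
  · have hcomb : ∀ x ∈ Icc a b, ∫ t in a..x, (s t : ℂ) * (u - (c / c₀) • u₀ : L2Icc a b) t =
        (c + ∫ t in a..x, (s t : ℂ) * u t) - c / c₀ * (c₀ + ∫ t in a..x, (s t : ℂ) * u₀ t) := by
      intro x hx
      have h1 := intervalIntegrable_left (intervalIntegrable_continuousOn_mul hab.le hs u) hx
      have h2 := intervalIntegrable_left (intervalIntegrable_continuousOn_mul hab.le hs u₀) hx
      have h3 : (fun t => (s t : ℂ) * (u - (c / c₀) • u₀ : L2Icc a b) t)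
          =ᵐ[volume.restrict (Icc a b)]
          fun t => (s t : ℂ) * u t - c / c₀ * ((s t : ℂ) * u₀ t) := by
        filter_upwards [Lp.coeFn_sub u ((c / c₀) • u₀), Lp.coeFn_smul (c / c₀) u₀] with t h1 h2
        rw [h1, Pi.sub_apply, h2, Pi.smul_apply, smul_eq_mul]
        ring
      rw [integral_congr_left h3 hx, intervalIntegral.integral_sub h1 (h2.const_mul _),
        intervalIntegral.integral_const_mul]
      field_simp
      ring
    have h4 : (∫ x in a..b, (e x : ℂ) ^ 2 *
        ∫ t in a..x, (s t : ℂ) * (u - (c / c₀) • u₀ : L2Icc a b) t) =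
        ∫ x in a..b, ((e x : ℂ) ^ 2 * (c + ∫ t in a..x, (s t : ℂ) * u t) -
          c / c₀ * ((e x : ℂ) ^ 2 * (c₀ + ∫ t in a..x, (s t : ℂ) * u₀ t))) := by
      refine intervalIntegral.integral_congr fun x hx => ?_
      rw [uIcc_of_le hab.le] at hx
      rw [hcomb x hx]
      ring
    rw [h4, intervalIntegral.integral_sub, intervalIntegral.integral_const_mul, hc, hc₀]
    · simp
    · exact (continuousOn_sturm_integrand hab.le he hs u c).intervalIntegrable_of_Icc hab.le
    · exact ((continuousOn_sturm_integrand hab.le he hs u₀ c₀).intervalIntegrable_of_Icc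
        hab.le).const_mul _

end Uniqueness

/-! ### The integrating factor and the symmetrizing weights. -/

section Weights

/-- The logarithm of the integrating factor: a primitive of `ε / (1 - x²)`. -/
noncomputable def logFactor (ε x : ℝ) : ℝ := ε / 2 * (Real.log (1 + x) - Real.log (1 - x))

/-- The weight `exp (-∫ ε / (1 - x²) / 2)`. -/
noncomputable def innerWeight (ε x : ℝ) : ℝ := Real.exp (-(logFactor ε x) / 2)

/-- The weight `exp (∫ ε / (1 - x²) / 2) / √(1 - x²)`. -/
noncomputable def outerWeight (ε x : ℝ) : ℝ := Real.exp (logFactor ε x / 2) / √(1 - x ^ 2)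

/-- The weight that turns `Ψ'` into the vector on which the self-adjoint operator acts. -/
noncomputable def stateWeight (ε x : ℝ) : ℝ := outerWeight ε x * (1 - x ^ 2)

variable {x₀ ε : ℝ}

lemma one_sub_sq_pos {x : ℝ} (hx₁ : x₀ < 1) (hx : x ∈ Icc (-x₀) x₀) : 0 < 1 - x ^ 2 := by
  nlinarith [hx.1, hx.2]

lemma hasDerivAt_logFactor {x : ℝ} (hx₁ : x₀ < 1) (hx : x ∈ Icc (-x₀) x₀) :
    HasDerivAt (logFactor ε) (ε / (1 - x ^ 2)) x := by
  have h1 : 1 + x ≠ 0 := by linarith [hx.1]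
  have h2 : 1 - x ≠ 0 := by linarith [hx.2]
  have h3 : 1 - x ^ 2 ≠ 0 := (one_sub_sq_pos hx₁ hx).ne'
  have h := ((((hasDerivAt_id x).const_add 1).log h1).sub
    (((hasDerivAt_id x).const_sub 1).log h2)).const_mul (ε / 2)
  convert! h using 1
  have h4 : 1 - x ^ 2 = (1 + x) * (1 - x) := by ring
  rw [h4]
  simp only [id]
  field_simp
  ring

lemma continuousOn_logFactor (hx₁ : x₀ < 1) : ContinuousOn (logFactor ε) (Icc (-x₀) x₀) :=
  fun _ hx => (hasDerivAt_logFactor hx₁ hx).continuousAt.continuousWithinAt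

lemma continuousOn_innerWeight (hx₁ : x₀ < 1) : ContinuousOn (innerWeight ε) (Icc (-x₀) x₀) :=
  Real.continuous_exp.comp_continuousOn ((continuousOn_logFactor hx₁).neg.div_const 2)

lemma continuousOn_one_sub_sq : ContinuousOn (fun x : ℝ => 1 - x ^ 2) (Icc (-x₀) x₀) := by
  fun_prop

lemma continuousOn_outerWeight (hx₁ : x₀ < 1) : ContinuousOn (outerWeight ε) (Icc (-x₀) x₀) :=
  (Real.continuous_exp.comp_continuousOn ((continuousOn_logFactor hx₁).div_const 2)).div
    (Real.continuous_sqrt.comp_continuousOn continuousOn_one_sub_sq)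
    fun _ hx => (Real.sqrt_pos.2 (one_sub_sq_pos hx₁ hx)).ne'

lemma continuousOn_stateWeight (hx₁ : x₀ < 1) : ContinuousOn (stateWeight ε) (Icc (-x₀) x₀) :=
  (continuousOn_outerWeight hx₁).mul continuousOn_one_sub_sq

lemma innerWeight_pos (x : ℝ) : 0 < innerWeight ε x := Real.exp_pos _

lemma outerWeight_pos {x : ℝ} (hx₁ : x₀ < 1) (hx : x ∈ Icc (-x₀) x₀) : 0 < outerWeight ε x :=
  div_pos (Real.exp_pos _) (Real.sqrt_pos.2 (one_sub_sq_pos hx₁ hx))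

lemma stateWeight_pos {x : ℝ} (hx₁ : x₀ < 1) (hx : x ∈ Icc (-x₀) x₀) : 0 < stateWeight ε x :=
  mul_pos (outerWeight_pos hx₁ hx) (one_sub_sq_pos hx₁ hx)

lemma innerWeight_sq (x : ℝ) : innerWeight ε x ^ 2 = Real.exp (-(logFactor ε x)) := by
  rw [innerWeight, ← Real.exp_nat_mul]
  congr 1
  push_cast
  ring

/-- This identity dictates the choice of weights: it writes `g ψ` as `s` times the state vector, so
that the same `s` appears on both sides of the operator. -/
lemma outerWeight_mul_stateWeight {x : ℝ} (hx₁ : x₀ < 1) (hx : x ∈ Icc (-x₀) x₀) :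
    outerWeight ε x * stateWeight ε x = Real.exp (logFactor ε x) := by
  have hw := one_sub_sq_pos hx₁ hx
  have hs := (Real.sqrt_pos.2 hw).ne'
  have h2 : Real.exp (logFactor ε x) = Real.exp (logFactor ε x / 2) ^ 2 := by
    rw [← Real.exp_nat_mul]
    congr 1
    push_cast
    ring
  have h3 := Real.sq_sqrt hw.le
  rw [stateWeight, outerWeight, h2]
  field_simp
  rw [h3]

lemma ofReal_eq_add_integral {k k' : ℝ → ℝ} {a b : ℝ}
    (hk : ∀ x ∈ Icc a b, HasDerivAt k (k' x) x) (hk' : ContinuousOn k' (Icc a b)) :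
    ∀ x ∈ Icc a b, (k x : ℂ) = k a + ∫ t in a..x, (k' t : ℂ) := by
  intro x hx
  have hsub : uIcc a x ⊆ Icc a b := by
    rw [uIcc_of_le hx.1]
    exact Icc_subset_Icc_right hx.2
  rw [intervalIntegral.integral_eq_sub_of_hasDerivAt (f := fun t => (k t : ℂ))
    (fun t ht => (hk t (hsub ht)).ofReal_comp)]
  · ring
  · exact (Complex.continuous_ofReal.comp_continuousOn (hk'.mono hsub)).intervalIntegrable

/-- The integrating factor is absolutely continuous. -/
lemma exp_logFactor_eq_add_integral (σ : ℝ) (hx₁ : x₀ < 1) : ∀ x ∈ Icc (-x₀) x₀,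
    (Real.exp (σ * logFactor ε x) : ℂ) = Real.exp (σ * logFactor ε (-x₀)) +
      ∫ t in (-x₀)..x, ((Real.exp (σ * logFactor ε t) * (σ * (ε / (1 - t ^ 2))) : ℝ) : ℂ) := by
  refine ofReal_eq_add_integral (k := fun x => Real.exp (σ * logFactor ε x))
    (fun x hx => ((hasDerivAt_logFactor hx₁ hx).const_mul σ).exp) ?_
  exact (Real.continuous_exp.comp_continuousOn ((continuousOn_logFactor hx₁).const_mul σ)).mul
    (continuousOn_const.mul (continuousOn_const.div continuousOn_one_sub_sq
      fun _ hx => (one_sub_sq_pos hx₁ hx).ne'))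

lemma continuousOn_exp_mul_deriv (σ : ℝ) (hx₁ : x₀ < 1) : ContinuousOn
    (fun t => ((Real.exp (σ * logFactor ε t) * (σ * (ε / (1 - t ^ 2))) : ℝ) : ℂ)) (Icc (-x₀) x₀) :=
  Complex.continuous_ofReal.comp_continuousOn
    ((Real.continuous_exp.comp_continuousOn ((continuousOn_logFactor hx₁).const_mul σ)).mul
    (continuousOn_const.mul (continuousOn_const.div continuousOn_one_sub_sq
      fun x hx => (one_sub_sq_pos hx₁ hx).ne')))

end Weights

/-! ### Functions with a derivative in `L²`, modulo constants. -/

section HasL2Deriv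

variable {x₀ : ℝ} {F f f' : ℝ → ℂ}

lemma HasL2Deriv.intervalIntegrable (hx₀ : 0 < x₀) (h : HasL2Deriv x₀ F f) :
    IntervalIntegrable f volume (-x₀) x₀ :=
  h.1.intervalIntegrable_Icc (by linarith)

lemma HasL2Deriv.ae_eq (hx₀ : 0 < x₀) (h : HasL2Deriv x₀ F f) (h' : HasL2Deriv x₀ F f') :
    f =ᵐ[volume.restrict (Icc (-x₀) x₀)] f' :=
  ae_eq_of_primitive_eq (by linarith) (h.intervalIntegrable hx₀) (h'.intervalIntegrable hx₀)
    fun x hx => add_left_cancel ((h.2 x hx).symm.trans (h'.2 x hx))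

lemma HasL2Deriv.congr (h : HasL2Deriv x₀ F f) (hf : f =ᵐ[volume.restrict (Icc (-x₀) x₀)] f') :
    HasL2Deriv x₀ F f' :=
  ⟨h.1.ae_eq hf, fun x hx => by rw [h.2 x hx, integral_congr_left hf hx]⟩

lemma hasL2Deriv_zero : HasL2Deriv x₀ 0 0 :=
  ⟨MemLp.zero, fun x _ => by simp⟩

lemma HasL2Deriv.isConstOn_iff (hx₀ : 0 < x₀) (h : HasL2Deriv x₀ F f) :
    IsConstOn x₀ F ↔ f =ᵐ[volume.restrict (Icc (-x₀) x₀)] 0 := by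
  constructor
  · rintro ⟨c, hc⟩
    refine h.ae_eq hx₀ ⟨MemLp.zero, fun x hx => ?_⟩
    rw [hc x hx, hc (-x₀) ⟨le_rfl, by linarith⟩]
    simp
  · intro h0
    refine ⟨F (-x₀), fun x hx => ?_⟩
    rw [(h.congr h0).2 x hx]
    simp

end HasL2Deriv

/-! ### Equivalence of the system and the operator equation, and comparison of norms. -/

section Translation

variable {x₀ ε : ℝ}

/-- The vector in `L²` that represents the function with derivative `ψ`. -/
noncomputable def stateVec (ε : ℝ) (hx₁ : x₀ < 1) {ψ : ℝ → ℂ}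
    (hψ : MemLp ψ 2 (volume.restrict (Icc (-x₀) x₀))) : L2Icc (-x₀) x₀ :=
  mulL2 (stateWeight ε) (continuousOn_stateWeight hx₁) (hψ.toLp ψ)

/-- The self-adjoint operator whose characteristic values are the eigenvalues of the system. -/
noncomputable def layerOp (ε : ℝ) (hx₀ : 0 < x₀) (hx₁ : x₀ < 1) :
    L2Icc (-x₀) x₀ →L[ℂ] L2Icc (-x₀) x₀ :=
  sturmOp (neg_lt_self hx₀).le (innerWeight ε) (outerWeight ε) (continuousOn_innerWeight hx₁)
    (continuousOn_outerWeight hx₁)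

lemma coeFn_stateVec (hx₁ : x₀ < 1) {ψ : ℝ → ℂ}
    (hψ : MemLp ψ 2 (volume.restrict (Icc (-x₀) x₀))) :
    stateVec ε hx₁ hψ =ᵐ[volume.restrict (Icc (-x₀) x₀)] fun x => (stateWeight ε x : ℂ) * ψ x := by
  filter_upwards [coeFn_mulL2 (continuousOn_stateWeight (ε := ε) hx₁) (hψ.toLp ψ),
    hψ.coeFn_toLp] with x h1 h2
  rw [stateVec, h1, h2]

lemma stateVec_congr (hx₁ : x₀ < 1) {ψ ψ' : ℝ → ℂ}
    (hψ : MemLp ψ 2 (volume.restrict (Icc (-x₀) x₀)))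
    (hψ' : MemLp ψ' 2 (volume.restrict (Icc (-x₀) x₀)))
    (h : ψ =ᵐ[volume.restrict (Icc (-x₀) x₀)] ψ') : stateVec ε hx₁ hψ = stateVec ε hx₁ hψ' := by
  rw [stateVec, stateVec, MemLp.toLp_congr hψ hψ' h]

lemma stateVec_eq_zero_iff (hx₁ : x₀ < 1) {ψ : ℝ → ℂ}
    (hψ : MemLp ψ 2 (volume.restrict (Icc (-x₀) x₀))) :
    stateVec ε hx₁ hψ = 0 ↔ ψ =ᵐ[volume.restrict (Icc (-x₀) x₀)] 0 := by
  rw [Lp.eq_zero_iff_ae_eq_zero]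
  constructor
  · intro h
    filter_upwards [h, coeFn_stateVec (ε := ε) hx₁ hψ, ae_restrict_mem measurableSet_Icc]
      with x h1 h2 hx
    rw [h2] at h1
    exact (mul_eq_zero.1 h1).resolve_left (by exact_mod_cast (stateWeight_pos hx₁ hx).ne')
  · intro h
    filter_upwards [h, coeFn_stateVec (ε := ε) hx₁ hψ] with x h1 h2
    rw [h2, h1, Pi.zero_apply, mul_zero]

lemma outerWeight_mul_state (hx₁ : x₀ < 1) {μ : ℂ} {ψ f : ℝ → ℂ}
    (hψ : MemLp ψ 2 (volume.restrict (Icc (-x₀) x₀)))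
    (hf : MemLp f 2 (volume.restrict (Icc (-x₀) x₀))) :
    (fun x => (outerWeight ε x : ℂ) *
      (μ • stateVec ε hx₁ hψ + stateVec ε hx₁ hf : L2Icc (-x₀) x₀) x)
      =ᵐ[volume.restrict (Icc (-x₀) x₀)]
      fun x => (Real.exp (logFactor ε x) : ℂ) * (μ * ψ x + f x) := by
  filter_upwards [Lp.coeFn_add (μ • stateVec ε hx₁ hψ) (stateVec ε hx₁ hf),
    Lp.coeFn_smul μ (stateVec ε hx₁ hψ), coeFn_stateVec (ε := ε) hx₁ hψ,
    coeFn_stateVec (ε := ε) hx₁ hf, ae_restrict_mem measurableSet_Icc] with x h1 h2 h3 h4 hx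
  rw [h1, Pi.add_apply, h2, Pi.smul_apply, h3, h4, ← outerWeight_mul_stateWeight hx₁ hx,
    smul_eq_mul]
  push_cast
  ring

/-- Solutions of the system solve the operator equation. -/
lemma System.stateVec_eq (hx₀ : 0 < x₀) (hx₁ : x₀ < 1) {μ : ℂ} {Ψ Φ F ψ f : ℝ → ℂ}
    (h : System x₀ ε μ Ψ Φ F) (hψ : HasL2Deriv x₀ Ψ ψ) (hf : HasL2Deriv x₀ F f) :
    stateVec ε hx₁ hψ.1 =
      layerOp ε hx₀ hx₁ (μ • stateVec ε hx₁ hψ.1 + stateVec ε hx₁ hf.1) := by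
  obtain ⟨ψ', φ, f', hψ', hl, hr, hΦ, hφ, hf', heq⟩ := h
  have hab : -x₀ ≤ x₀ := by linarith
  have hfae := hf'.ae_eq hx₀ hf
  rw [stateVec_congr hx₁ hψ.1 hψ'.1 (hψ.ae_eq hx₀ hψ')]
  set v := μ • stateVec ε hx₁ hψ'.1 + stateVec ε hx₁ hf.1 with hv
  -- The initial value of `g Φ` is the constant that `coeFn_sturmOp` needs; the condition on it will
  -- come from `ψ x₀ = 0`.
  set c : ℂ := (Real.exp (logFactor ε (-x₀)) : ℂ) * Φ (-x₀) with hc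
  have hp : ∀ x ∈ Icc (-x₀) x₀, ((1 - x ^ 2 : ℝ) : ℂ) * ψ' x = ∫ t in (-x₀)..x, Φ t := by
    intro x hx
    have := hΦ.2 x hx
    simp only [hl, mul_zero, zero_add] at this
    exact this
  have hgΦ : ∀ x ∈ Icc (-x₀) x₀, (Real.exp (logFactor ε x) : ℂ) * Φ x =
      c + ∫ t in (-x₀)..x, (outerWeight ε t : ℂ) * v t := by
    intro x hx
    have hk := exp_logFactor_eq_add_integral (ε := ε) 1 hx₁
    have hk' := continuousOn_exp_mul_deriv (ε := ε) 1 hx₁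
    simp only [one_mul] at hk hk'
    have hmul := (primitive_mul_primitive hab (F := fun x => (Real.exp (logFactor ε x) : ℂ))
      (hk'.intervalIntegrable_of_Icc hab) (hφ.intervalIntegrable hx₀) hk hφ.2).2 x hx
    rw [hmul]
    congr 1
    refine integral_congr_left ?_ hx
    filter_upwards [outerWeight_mul_state (ε := ε) (μ := μ) hx₁ hψ'.1 hf.1, heq, hfae]
      with t h1 h2 h3
    rw [h1, ← h3, ← h2]
    push_cast
    ring
  have hΦeq : ∀ x ∈ Icc (-x₀) x₀, Φ x = (innerWeight ε x : ℂ) ^ 2 *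
      (c + ∫ t in (-x₀)..x, (outerWeight ε t : ℂ) * v t) := by
    intro x hx
    rw [← hgΦ x hx, ← mul_assoc]
    have : innerWeight ε x ^ 2 * Real.exp (logFactor ε x) = 1 := by
      rw [innerWeight_sq, ← Real.exp_add, neg_add_cancel, Real.exp_zero]
    have h2 : (innerWeight ε x : ℂ) ^ 2 * (Real.exp (logFactor ε x) : ℂ) = 1 := by
      exact_mod_cast this
    rw [h2, one_mul]
  have hint : ∀ x ∈ Icc (-x₀) x₀, ∫ t in (-x₀)..x, Φ t = ∫ t in (-x₀)..x, (innerWeight ε t : ℂ) ^ 2 *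
      (c + ∫ r in (-x₀)..t, (outerWeight ε r : ℂ) * v r) := by
    intro x hx
    refine integral_congr_left ?_ hx
    filter_upwards [ae_restrict_mem measurableSet_Icc] with t ht using hΦeq t ht
  have hbb : x₀ ∈ Icc (-x₀) x₀ := ⟨hab, le_rfl⟩
  have h0 := hint x₀ hbb
  rw [← hp x₀ hbb, hr, mul_zero] at h0
  refine Lp.ext ?_
  filter_upwards [coeFn_sturmOp hab (continuousOn_innerWeight hx₁) (continuousOn_outerWeight hx₁) v
    h0.symm, coeFn_stateVec (ε := ε) hx₁ hψ'.1, ae_restrict_mem measurableSet_Icc] with x h1 h2 hx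
  rw [layerOp, h1, h2, ← hint x hx, ← hp x hx, stateWeight]
  push_cast
  ring

/-- Solutions of the operator equation give solutions of the system. -/
lemma exists_system_of_eq (hx₀ : 0 < x₀) (hx₁ : x₀ < 1) {μ : ℂ} {F f : ℝ → ℂ}
    (hf : HasL2Deriv x₀ F f) {u : L2Icc (-x₀) x₀}
    (hu : u = layerOp ε hx₀ hx₁ (μ • u + stateVec ε hx₁ hf.1)) :
    ∃ Ψ Φ ψ : ℝ → ℂ, System x₀ ε μ Ψ Φ F ∧
      ∃ hψ : HasL2Deriv x₀ Ψ ψ, stateVec ε hx₁ hψ.1 = u := by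
  have hab : -x₀ < x₀ := by linarith
  have haa : -x₀ ∈ Icc (-x₀) x₀ := ⟨le_rfl, hab.le⟩
  have hbb : x₀ ∈ Icc (-x₀) x₀ := ⟨hab.le, le_rfl⟩
  have he := continuousOn_innerWeight (ε := ε) hx₁
  have hs := continuousOn_outerWeight (ε := ε) hx₁
  set v := μ • u + stateVec ε hx₁ hf.1 with hv
  obtain ⟨c, hc⟩ := exists_sturm_const hab he hs (fun x _ => innerWeight_pos x) v
  have hAv := coeFn_sturmOp hab.le he hs v hc
  have hsv := intervalIntegrable_continuousOn_mul hab.le hs v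
  have hsvL := MemLp.continuousOn_mul hs (Lp.memLp v)
  set Φ : ℝ → ℂ := fun x => (innerWeight ε x : ℂ) ^ 2 *
    (c + ∫ t in (-x₀)..x, (outerWeight ε t : ℂ) * v t) with hΦdef
  have hΦc : ContinuousOn Φ (Icc (-x₀) x₀) := continuousOn_sturm_integrand hab.le he hs v c
  have hΦi := hΦc.intervalIntegrable_of_Icc (μ := volume) hab.le
  have hw0 : ∀ x ∈ Icc (-x₀) x₀, ((1 - x ^ 2 : ℝ) : ℂ) ≠ 0 := fun x hx => by
    exact_mod_cast (one_sub_sq_pos hx₁ hx).ne'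
  have hwc : ContinuousOn (fun x : ℝ => ((1 - x ^ 2 : ℝ) : ℂ)) (Icc (-x₀) x₀) :=
    Complex.continuous_ofReal.comp_continuousOn continuousOn_one_sub_sq
  -- `ψ` is defined pointwise rather than from the class `u`, so that its boundary values make
  -- sense: it vanishes at `-x₀` by construction and at `x₀` by `hc`.
  set ψ : ℝ → ℂ := fun x => (∫ t in (-x₀)..x, Φ t) / ((1 - x ^ 2 : ℝ) : ℂ) with hψdef
  have hψc : ContinuousOn ψ (Icc (-x₀) x₀) :=
    (continuousOn_primitive_left hab.le hΦi).div hwc hw0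
  have hψL : HasL2Deriv x₀ (fun x => ∫ t in (-x₀)..x, ψ t) ψ :=
    ⟨memLp_of_continuousOn hψc, fun x _ => by simp⟩
  have hwψ : ∀ x ∈ Icc (-x₀) x₀, ((1 - x ^ 2 : ℝ) : ℂ) * ψ x = ∫ t in (-x₀)..x, Φ t :=
    fun x hx => mul_div_cancel₀ _ (hw0 x hx)
  have huψ : stateVec ε hx₁ hψL.1 = u := by
    refine Lp.ext ?_
    have hu' : u = sturmOp hab.le (innerWeight ε) (outerWeight ε) he hs v := hu
    rw [← hu'] at hAv
    filter_upwards [hAv, coeFn_stateVec (ε := ε) hx₁ hψL.1, ae_restrict_mem measurableSet_Icc]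
      with x h1 h2 hx
    rw [h1, h2, ← hwψ x hx, stateWeight]
    push_cast
    ring
  -- The product rule for `Φ = e² (c + ∫ s v)`, where `(e²)' = -ε / (1 - x²) * e²`.
  set φ : ℝ → ℂ := fun x => -(((ε / (1 - x ^ 2) : ℝ) : ℂ) * Φ x) +
    (innerWeight ε x : ℂ) ^ 2 * ((outerWeight ε x : ℂ) * v x) with hφdef
  have hΦL : HasL2Deriv x₀ Φ φ := by
    refine ⟨?_, fun x hx => ?_⟩
    · refine (MemLp.continuousOn_mul (k := fun x => ε / (1 - x ^ 2))
        (continuousOn_const.div continuousOn_one_sub_sq fun x hx => (one_sub_sq_pos hx₁ hx).ne')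
        (memLp_of_continuousOn hΦc)).neg.add ?_
      have := MemLp.continuousOn_mul (k := fun x => innerWeight ε x ^ 2) (he.pow 2) hsvL
      push_cast at this
      exact this
    · have hk := exp_logFactor_eq_add_integral (ε := ε) (-1) hx₁
      have hk' := continuousOn_exp_mul_deriv (ε := ε) (-1) hx₁
      have hE (x : ℝ) : (Real.exp (-1 * logFactor ε x) : ℂ) = (innerWeight ε x : ℂ) ^ 2 := by
        rw [neg_one_mul, ← innerWeight_sq]
        push_cast
        rfl
      have hmul := (primitive_mul_primitive hab.le
        (F := fun x => (Real.exp (-1 * logFactor ε x) : ℂ))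
        (G := fun x => c + ∫ t in (-x₀)..x, (outerWeight ε t : ℂ) * v t)
        (hk'.intervalIntegrable_of_Icc hab.le) hsv hk (fun x _ => by simp)).2 x hx
      simp only [hE] at hmul
      change Φ x = Φ (-x₀) + _ at hmul
      rw [hmul]
      congr 1
      refine integral_congr_left (Filter.Eventually.of_forall fun t => ?_) hx
      simp only [hφdef, hΦdef, Complex.ofReal_mul, hE]
      push_cast
      ring
  refine ⟨_, Φ, ψ, ⟨ψ, φ, f, hψL, ?_, ?_, ?_, hΦL, hf, ?_⟩, hψL, huψ⟩
  · simp [hψdef]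
  · simp only [hψdef]
    rw [hc, zero_div]
  · refine ⟨memLp_of_continuousOn hΦc, fun x hx => ?_⟩
    simp only
    rw [hwψ x hx, hwψ _ haa, intervalIntegral.integral_same, zero_add]
  · have h := outerWeight_mul_state (ε := ε) (μ := μ) hx₁ hψL.1 hf.1
    rw [huψ, ← hv] at h
    filter_upwards [h] with x h1
    have h2 : (innerWeight ε x : ℂ) ^ 2 * (Real.exp (logFactor ε x) : ℂ) = 1 := by
      have : innerWeight ε x ^ 2 * Real.exp (logFactor ε x) = 1 := by
        rw [innerWeight_sq, ← Real.exp_add, neg_add_cancel, Real.exp_zero]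
      exact_mod_cast this
    simp only [hφdef, h1]
    linear_combination (μ * ψ x + f x) * h2

lemma mulL2_mulL2 {a b : ℝ} {k l m : ℝ → ℝ} (hk : ContinuousOn k (Icc a b))
    (hl : ContinuousOn l (Icc a b)) (hm : ContinuousOn m (Icc a b))
    (h : ∀ x ∈ Icc a b, k x * l x = m x) (u : L2Icc a b) :
    mulL2 k hk (mulL2 l hl u) = mulL2 m hm u := by
  refine Lp.ext ?_
  filter_upwards [coeFn_mulL2 hk (mulL2 l hl u), coeFn_mulL2 hl u, coeFn_mulL2 hm u,
    ae_restrict_mem measurableSet_Icc] with x h1 h2 h3 hx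
  rw [h1, h2, h3, ← h x hx]
  push_cast
  ring

lemma continuousOn_sqrt_one_sub_sq : ContinuousOn (fun x : ℝ => √(1 - x ^ 2)) (Icc (-x₀) x₀) :=
  Real.continuous_sqrt.comp_continuousOn continuousOn_one_sub_sq

lemma energySq_eq_norm_sq (hx₀ : 0 < x₀) (hx₁ : x₀ < 1) {f : ℝ → ℂ}
    (hf : MemLp f 2 (volume.restrict (Icc (-x₀) x₀))) :
    energySq x₀ f =
      ‖mulL2 (fun x => √(1 - x ^ 2)) continuousOn_sqrt_one_sub_sq (hf.toLp f)‖ ^ 2 := by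
  have hab : -x₀ ≤ x₀ := by linarith
  set u := mulL2 (fun x => √(1 - x ^ 2)) continuousOn_sqrt_one_sub_sq (hf.toLp f) with hu
  have h1 : ((‖u‖ ^ 2 : ℝ) : ℂ) = (energySq x₀ f : ℂ) := by
    have h2 : (inner ℂ u u : ℂ) = ((‖u‖ ^ 2 : ℝ) : ℂ) := by
      rw [inner_self_eq_norm_sq_to_K]
      simp
    rw [← h2, inner_L2_eq_integral hab, energySq, ← intervalIntegral.integral_ofReal]
    refine integral_congr_left ?_ ⟨hab, le_rfl⟩
    filter_upwards [coeFn_mulL2 (k := fun x : ℝ => √(1 - x ^ 2)) continuousOn_sqrt_one_sub_sq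
      (hf.toLp f), hf.coeFn_toLp, ae_restrict_mem measurableSet_Icc] with x h1 h2 hx
    rw [hu, h1, h2, map_mul, Complex.conj_ofReal]
    have h3 : ((1 - x ^ 2 : ℝ) : ℂ) = (√(1 - x ^ 2) : ℂ) * (√(1 - x ^ 2) : ℂ) := by
      exact_mod_cast (Real.mul_self_sqrt (one_sub_sq_pos hx₁ hx).le).symm
    rw [Complex.ofReal_mul, h3, Complex.ofReal_pow, ← Complex.conj_mul' (f x)]
    ring
  exact_mod_cast h1.symm

/-- The energy norm and the norm of `stateVec` are weighted `L²` norms whose weights have a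
continuous quotient on the compact interval. Together with the reverse estimate, this transfers
operator bounds to the energy norm. -/
lemma exists_energySq_le (ε : ℝ) (hx₀ : 0 < x₀) (hx₁ : x₀ < 1) :
    ∃ C : ℝ, ∀ (f : ℝ → ℂ) (hf : MemLp f 2 (volume.restrict (Icc (-x₀) x₀))),
      energySq x₀ f ≤ C * ‖stateVec ε hx₁ hf‖ ^ 2 := by
  have hk : ContinuousOn (fun x => √(1 - x ^ 2) / stateWeight ε x) (Icc (-x₀) x₀) :=
    continuousOn_sqrt_one_sub_sq.div (continuousOn_stateWeight hx₁)
      fun x hx => (stateWeight_pos hx₁ hx).ne'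
  refine ⟨‖mulL2 _ hk‖ ^ 2, fun f hf => ?_⟩
  rw [energySq_eq_norm_sq hx₀ hx₁ hf, ← mul_pow, stateVec,
    ← mulL2_mulL2 hk (continuousOn_stateWeight hx₁) continuousOn_sqrt_one_sub_sq
      fun x hx => div_mul_cancel₀ _ (stateWeight_pos hx₁ hx).ne']
  gcongr
  exact ContinuousLinearMap.le_opNorm _ _

lemma exists_norm_sq_stateVec_le (ε : ℝ) (hx₀ : 0 < x₀) (hx₁ : x₀ < 1) :
    ∃ C : ℝ, ∀ (f : ℝ → ℂ) (hf : MemLp f 2 (volume.restrict (Icc (-x₀) x₀))),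
      ‖stateVec ε hx₁ hf‖ ^ 2 ≤ C * energySq x₀ f := by
  have hw : ∀ x ∈ Icc (-x₀) x₀, √(1 - x ^ 2) ≠ 0 :=
    fun x hx => (Real.sqrt_pos.2 (one_sub_sq_pos hx₁ hx)).ne'
  have hk : ContinuousOn (fun x => stateWeight ε x / √(1 - x ^ 2)) (Icc (-x₀) x₀) :=
    (continuousOn_stateWeight hx₁).div continuousOn_sqrt_one_sub_sq hw
  refine ⟨‖mulL2 _ hk‖ ^ 2, fun f hf => ?_⟩
  rw [energySq_eq_norm_sq hx₀ hx₁ hf, ← mul_pow, stateVec,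
    ← mulL2_mulL2 hk continuousOn_sqrt_one_sub_sq (continuousOn_stateWeight hx₁)
      fun x hx => div_mul_cancel₀ _ (hw x hx)]
  gcongr
  exact ContinuousLinearMap.le_opNorm _ _

end Translation

/-! ### Spectral properties of the system, read off from the operator. -/

section Spectrum

variable {x₀ ε : ℝ}

lemma stateVec_zero (hx₁ : x₀ < 1) :
    stateVec ε hx₁ (hasL2Deriv_zero (x₀ := x₀)).1 = 0 :=
  (stateVec_eq_zero_iff hx₁ _).2 (Filter.EventuallyEq.refl _ _)

lemma System.exists_hasL2Deriv {μ : ℂ} {Ψ Φ F : ℝ → ℂ} (h : System x₀ ε μ Ψ Φ F) :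
    ∃ ψ, HasL2Deriv x₀ Ψ ψ := by
  obtain ⟨ψ, -, -, hψ, -⟩ := h
  exact ⟨ψ, hψ⟩

lemma System.stateVec_eq_smul (hx₀ : 0 < x₀) (hx₁ : x₀ < 1) {μ : ℂ} {Ψ Φ ψ : ℝ → ℂ}
    (h : System x₀ ε μ Ψ Φ 0) (hψ : HasL2Deriv x₀ Ψ ψ) :
    stateVec ε hx₁ hψ.1 = μ • layerOp ε hx₀ hx₁ (stateVec ε hx₁ hψ.1) := by
  have := h.stateVec_eq hx₀ hx₁ hψ hasL2Deriv_zero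
  rwa [stateVec_zero, add_zero, map_smul] at this

lemma exists_system_of_eq_smul (hx₀ : 0 < x₀) (hx₁ : x₀ < 1) {μ : ℂ} {u : L2Icc (-x₀) x₀}
    (hu : u = μ • layerOp ε hx₀ hx₁ u) :
    ∃ Ψ Φ ψ : ℝ → ℂ, System x₀ ε μ Ψ Φ 0 ∧
      ∃ hψ : HasL2Deriv x₀ Ψ ψ, stateVec ε hx₁ hψ.1 = u := by
  refine exists_system_of_eq hx₀ hx₁ hasL2Deriv_zero ?_
  rw [stateVec_zero, add_zero, map_smul]
  exact hu

lemma isConstOn_iff_stateVec_eq_zero (hx₀ : 0 < x₀) (hx₁ : x₀ < 1) {Ψ ψ : ℝ → ℂ}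
    (hψ : HasL2Deriv x₀ Ψ ψ) : IsConstOn x₀ Ψ ↔ stateVec ε hx₁ hψ.1 = 0 := by
  rw [hψ.isConstOn_iff hx₀, stateVec_eq_zero_iff]

lemma isEigenvalue_iff_isCharValue (hx₀ : 0 < x₀) (hx₁ : x₀ < 1) {μ : ℂ} :
    IsEigenvalue x₀ ε μ ↔ IsCharValue (layerOp ε hx₀ hx₁) μ := by
  constructor
  · rintro ⟨Ψ, Φ, h, hne⟩
    obtain ⟨ψ, hψ⟩ := h.exists_hasL2Deriv
    rw [isConstOn_iff_stateVec_eq_zero (ε := ε) hx₀ hx₁ hψ] at hne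
    exact ⟨_, hne, h.stateVec_eq_smul hx₀ hx₁ hψ⟩
  · rintro ⟨u, hne, hu⟩
    obtain ⟨Ψ, Φ, ψ, h, hψ, rfl⟩ := exists_system_of_eq_smul hx₀ hx₁ hu
    exact ⟨Ψ, Φ, h, fun hc => hne ((isConstOn_iff_stateVec_eq_zero hx₀ hx₁ hψ).1 hc)⟩

/-- The operator equation reads `(1 - μ T) u = T v`, so its solution is `u = R (T v)` with `R = (1 -
μ T)⁻¹`, and the bound is that of `R T`. -/
lemma isResolventPoint_of_not_isCharValue (hx₀ : 0 < x₀) (hx₁ : x₀ < 1) {μ : ℂ}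
    (h : ¬ IsCharValue (layerOp ε hx₀ hx₁) μ) : IsResolventPoint x₀ ε μ := by
  obtain ⟨R, hR⟩ := exists_inverse_of_not_isCharValue
    (isCompactOperator_sturmOp (neg_lt_self hx₀).le (continuousOn_innerWeight hx₁)
      (continuousOn_outerWeight hx₁)) h
  refine ⟨fun F f hf => ?_, fun Ψ Φ hS => ?_, ?_⟩
  · obtain ⟨Ψ, Φ, -, hS, -⟩ := exists_system_of_eq (ε := ε) (μ := μ) hx₀ hx₁ hf
      (u := R (layerOp ε hx₀ hx₁ (stateVec ε hx₁ hf.1))) (by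
        rw [map_add, map_smul]
        exact (hR _ _).2 rfl)
    exact ⟨Ψ, Φ, hS⟩
  · by_contra hne
    exact h ((isEigenvalue_iff_isCharValue hx₀ hx₁).1 ⟨Ψ, Φ, hS, hne⟩)
  · obtain ⟨C₁, hC₁⟩ := exists_energySq_le ε hx₀ hx₁
    obtain ⟨C₂, hC₂⟩ := exists_norm_sq_stateVec_le ε hx₀ hx₁
    set B := R ∘L layerOp ε hx₀ hx₁ with hB
    -- The sign of `C₁` is not recorded, and the monotonicity steps need a nonnegative factor.
    refine ⟨max C₁ 0 * (‖B‖ ^ 2 * C₂), fun Ψ ψ Φ F f hS hψ hf => ?_⟩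
    have h1 := hS.stateVec_eq hx₀ hx₁ hψ hf
    rw [map_add, map_smul] at h1
    have h2 : stateVec ε hx₁ hψ.1 = B (stateVec ε hx₁ hf.1) := (hR _ _).1 h1
    calc energySq x₀ ψ ≤ C₁ * ‖stateVec ε hx₁ hψ.1‖ ^ 2 := hC₁ ψ hψ.1
      _ ≤ max C₁ 0 * ‖stateVec ε hx₁ hψ.1‖ ^ 2 := by
          gcongr
          exact le_max_left _ _
      _ ≤ max C₁ 0 * (‖B‖ * ‖stateVec ε hx₁ hf.1‖) ^ 2 := by
          have : 0 ≤ max C₁ 0 := le_max_right _ _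
          gcongr
          rw [h2]
          exact B.le_opNorm _
      _ = max C₁ 0 * (‖B‖ ^ 2 * ‖stateVec ε hx₁ hf.1‖ ^ 2) := by ring
      _ ≤ max C₁ 0 * (‖B‖ ^ 2 * (C₂ * energySq x₀ f)) := by
          have : 0 ≤ max C₁ 0 := le_max_right _ _
          gcongr
          exact hC₂ f hf.1
      _ = _ := by ring

lemma layerSpectrum_eq (hx₀ : 0 < x₀) (hx₁ : x₀ < 1) :
    layerSpectrum x₀ ε = {μ | IsCharValue (layerOp ε hx₀ hx₁) μ} := by
  ext μ
  constructor
  · intro h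
    by_contra hc
    exact h (isResolventPoint_of_not_isCharValue hx₀ hx₁ hc)
  · rintro h ⟨-, huniq, -⟩
    obtain ⟨Ψ, Φ, hS, hne⟩ := (isEigenvalue_iff_isCharValue hx₀ hx₁).2 h
    exact hne (huniq Ψ Φ hS)

lemma isGeometricallySimple_of_isCharValue (hx₀ : 0 < x₀) (hx₁ : x₀ < 1) {μ : ℂ}
    (h : IsCharValue (layerOp ε hx₀ hx₁) μ) : IsGeometricallySimple x₀ ε μ := by
  obtain ⟨Ψ₀, Φ₀, hS₀, hne₀⟩ := (isEigenvalue_iff_isCharValue hx₀ hx₁).2 h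
  refine ⟨Ψ₀, Φ₀, ⟨hS₀, hne₀⟩, fun Ψ Φ hS => ?_⟩
  obtain ⟨ψ₀, hψ₀⟩ := hS₀.exists_hasL2Deriv
  obtain ⟨ψ, hψ⟩ := hS.exists_hasL2Deriv
  rw [isConstOn_iff_stateVec_eq_zero (ε := ε) hx₀ hx₁ hψ₀] at hne₀
  obtain ⟨c, hc⟩ := exists_smul_eq_of_sturm (neg_lt_self hx₀) (continuousOn_innerWeight hx₁)
    (continuousOn_outerWeight hx₁) (fun x _ => innerWeight_pos x)
    (hS.stateVec_eq_smul hx₀ hx₁ hψ) (hS₀.stateVec_eq_smul hx₀ hx₁ hψ₀) hne₀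
  have hae : ψ =ᵐ[volume.restrict (Icc (-x₀) x₀)] fun x => c * ψ₀ x := by
    have h1 := Lp.coeFn_smul c (stateVec ε hx₁ hψ₀.1)
    rw [← hc] at h1
    filter_upwards [h1, coeFn_stateVec (ε := ε) hx₁ hψ.1, coeFn_stateVec (ε := ε) hx₁ hψ₀.1,
      ae_restrict_mem measurableSet_Icc] with x h1 h2 h3 hx
    rw [h2, Pi.smul_apply, h3, smul_eq_mul, mul_left_comm] at h1
    exact mul_left_cancel₀ (by exact_mod_cast (stateWeight_pos hx₁ hx).ne') h1
  refine ⟨c, Ψ (-x₀) - c * Ψ₀ (-x₀), fun x hx => ?_⟩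
  rw [(hψ.congr hae).2 x hx, hψ₀.2 x hx, intervalIntegral.integral_const_mul]
  ring

lemma isSymmetric_layerOp (hx₀ : 0 < x₀) (hx₁ : x₀ < 1) : (layerOp ε hx₀ hx₁).IsSymmetric :=
  isSymmetric_sturmOp _ _ _

lemma IsCharValue.layerOp_real_neg {hx₀ : 0 < x₀} {hx₁ : x₀ < 1} {μ : ℂ}
    (h : IsCharValue (layerOp ε hx₀ hx₁) μ) : μ.im = 0 ∧ μ.re < 0 :=
  h.real_neg (isSymmetric_layerOp hx₀ hx₁) (re_inner_sturmOp_nonpos _ _ _)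

/-- A chain would give `u₁ = μ T u₁ + T u` with `u = μ T u`. Pairing with `u`, and using that `T` is
symmetric and `μ` real, leaves `⟪u, T u⟫ = 0`, whence `‖u‖² = μ ⟪u, T u⟫ = 0`. -/
lemma hasNoJordanChain_of_isCharValue (hx₀ : 0 < x₀) (hx₁ : x₀ < 1) {μ : ℂ}
    (h : IsCharValue (layerOp ε hx₀ hx₁) μ) : HasNoJordanChain x₀ ε μ := by
  rintro Ψ Φ ⟨hS, hne⟩ Ψ₁ Φ₁ hS₁
  obtain ⟨ψ, hψ⟩ := hS.exists_hasL2Deriv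
  obtain ⟨ψ₁, hψ₁⟩ := hS₁.exists_hasL2Deriv
  rw [isConstOn_iff_stateVec_eq_zero (ε := ε) hx₀ hx₁ hψ] at hne
  have h0 := hS.stateVec_eq_smul hx₀ hx₁ hψ
  have h1 := hS₁.stateVec_eq hx₀ hx₁ hψ₁ hψ
  have hreal : (starRingEnd ℂ) μ = μ := Complex.conj_eq_iff_im.2 h.layerOp_real_neg.1
  set T := layerOp ε hx₀ hx₁ with hT
  set u := stateVec ε hx₁ hψ.1
  set u₁ := stateVec ε hx₁ hψ₁.1
  have hsym : (inner ℂ (T u) u₁ : ℂ) = inner ℂ u (T u₁) := isSymmetric_layerOp hx₀ hx₁ u u₁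
  have h2 : (inner ℂ u u₁ : ℂ) = μ * inner ℂ u (T u₁) := by
    conv_lhs => rw [h0]
    rw [inner_smul_left, hreal, hsym]
  have h3 : (inner ℂ u u₁ : ℂ) = μ * inner ℂ u (T u₁) + inner ℂ u (T u) := by
    conv_lhs => rw [h1]
    rw [map_add, map_smul, inner_add_right, inner_smul_right]
  have h4 : (inner ℂ u (T u) : ℂ) = 0 := by
    rw [h2] at h3
    exact left_eq_add.1 h3
  have h5 : (inner ℂ u u : ℂ) = μ * inner ℂ u (T u) :=
    (congrArg (inner ℂ u) h0).trans (inner_smul_right _ _ _)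
  rw [h4, mul_zero, inner_self_eq_zero] at h5
  exact hne h5

end Spectrum

end SphericalLayer

theorem proposition9 (x₀ ε : ℝ) (hx₀ : 0 < x₀) (hx₁ : x₀ < 1) (hε : 0 ≤ ε) :
    SphericalLayer.layerSpectrum x₀ ε = {μ : ℂ | SphericalLayer.IsEigenvalue x₀ ε μ} ∧
    (SphericalLayer.layerSpectrum x₀ ε).Infinite ∧
    ∀ μ ∈ SphericalLayer.layerSpectrum x₀ ε,
      (μ.im = 0 ∧ μ.re < 0) ∧
      (SphericalLayer.IsGeometricallySimple x₀ ε μ ∧ SphericalLayer.HasNoJordanChain x₀ ε μ) ∧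
      ∃ δ > 0, ∀ ν ∈ SphericalLayer.layerSpectrum x₀ ε, ν ≠ μ → δ ≤ dist ν μ := by
  have hab := neg_lt_self hx₀
  have he := SphericalLayer.continuousOn_innerWeight (ε := ε) hx₁
  have hs := SphericalLayer.continuousOn_outerWeight (ε := ε) hx₁
  have hcpt : IsCompactOperator (SphericalLayer.layerOp ε hx₀ hx₁) :=
    SphericalLayer.isCompactOperator_sturmOp hab.le he hs
  have hsym := SphericalLayer.isSymmetric_layerOp (ε := ε) hx₀ hx₁
  rw [SphericalLayer.layerSpectrum_eq hx₀ hx₁]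
  refine ⟨?_, ?_, fun μ hμ => ⟨hμ.layerOp_real_neg,
    ⟨SphericalLayer.isGeometricallySimple_of_isCharValue hx₀ hx₁ hμ,
      SphericalLayer.hasNoJordanChain_of_isCharValue hx₀ hx₁ hμ⟩, hμ.isolated hcpt hsym⟩⟩
  · ext μ
    exact (SphericalLayer.isEigenvalue_iff_isCharValue hx₀ hx₁).symm
  · exact SphericalLayer.isCharValue_infinite hcpt hsym
      (fun u hu => SphericalLayer.eq_zero_of_sturmOp_eq_zero hab he hs
        (fun x _ => SphericalLayer.innerWeight_pos x)
        (fun x hx => SphericalLayer.outerWeight_pos hx₁ hx) hu)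
      (SphericalLayer.not_finiteDimensional_L2Icc hab)
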